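/- Let $(M,Q)$ be a polarised Riemann surface: $M$ is a connected Riemann surface and $Q$ a holomorphic quadratic differential on $M$, not identically zero. Vectors of $\mathbb{R}^n$ are multiplied and inverted in the Clifford algebra $C\ell_n$ with $vw+wv=-2(v,w)$, so that $v^{-1}=-v/(v,v)$ for $v\neq 0$, and $\wedge$ of $\mathbb{R}^n$-valued $1$-forms uses this product. A *Christoffel transform* of a smooth map $f:M\to\mathbb{R}^n$ is a smooth map $f^c:M\to\mathbb{R}^n$ with $df\wedge df^c=0$ and $(df,df^c)^{2,0}=Q$. The map $f$ is *isothermic* on $(M,Q)$ if it is a conformal immersion, except possibly for branch points at zeros of $Q$, and has a Christoffel transform. For $f$ isothermic and $r\in\mathbb{R}^\times$ we write $\hat f=\mathcal{D}_r f$ if $\hat f$ is smooth, $g=\hat f-f$ has no zeros and $dg=r\,g\,df^c\,g-df$. A *Bianchi quadrilateral* with parameters $r_1,r_2\in\mathbb{R}^\times$ is a quadruple $(f,f_1,\hat f,f_2)$ of isothermic surfaces on $(M,Q)$ with $f_1=\mathcal{D}_{r_1}f$ and $f_2=\mathcal{D}_{r_2}f$ distinct, $\hat f=\mathcal{D}_{r_2}f_1=\mathcal{D}_{r_1}f_2$,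 and such that corresponding points of $f,f_1,\hat f,f_2$ lie on a common circle or line and have Clifford cross-ratio $$(f-f_1)(f_1-\hat f)^{-1}(\hat f-f_2)(f_2-f)^{-1}=\frac{r_2}{r_1}.$$ **Theorem.** Let $(f,f_1,\hat f,f_2)$ be a Bianchi quadrilateral with parameters $r_1,r_2$, and let $f^c$ be a Christoffel transform of $f$. Put $g_1=f_1-f$, $g_2=f_2-f$, $g_{12}=\hat f-f_1$, $g_{21}=\hat f-f_2$, and $$f_1^c=f^c+(r_1g_1)^{-1},\qquad f_2^c=f^c+(r_2g_2)^{-1}.$$ Then $f_1^c$ and $f_2^c$ are Christoffel transforms of $f_1$ and $f_2$, and there is a unique map $\hat f^c:M\to\mathbb{R}^n$ such that $(f^c,f_1^c,\hat f^c,f_2^c)$ is a Bianchi quadrilateral with parameters $r_1,r_2$. This $\hat f^c$ is a Christoffel transform of $\hat f$, and the three candidate Christoffel transforms of $\hat f$ coincide exactly (not just up to translation): $$\hat f^c=f_1^c+(r_2g_{12})^{-1}=f_2^c+(r_1g_{21})^{-1}.$$ -/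

import Mathlib

open scoped Manifold ContDiff

namespace Isothermic

noncomputable section

/-- Euclidean `n`-space. -/
abbrev Rn (n : ℕ) : Type := EuclideanSpace ℝ (Fin n)

/-- The negative definite quadratic form `v ↦ -(v, v)` on Euclidean space. -/
def negNormSq (n : ℕ) : QuadraticForm ℝ (Rn n) :=
  -(LinearMap.BilinMap.toQuadraticMap (innerₗ (Rn n)))

theorem negNormSq_apply {n : ℕ} (v : Rn n) : negNormSq n v = -‖v‖ ^ 2 := by
  simp [negNormSq]

/-- The Clifford algebra of Euclidean `n`-space, with the convention
`v w + w v = -2 (v, w)`. -/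
abbrev Cl (n : ℕ) : Type := CliffordAlgebra (negNormSq n)

/-- The inclusion of Euclidean space into its Clifford algebra. -/
def emb {n : ℕ} (v : Rn n) : Cl n := CliffordAlgebra.ι (negNormSq n) v

/-- The Clifford inverse `v⁻¹ = -v / (v, v)` of a non-zero vector `v`, which is again a vector
(and `0` for `v = 0`). -/
def vinv {n : ℕ} (v : Rn n) : Rn n := -((‖v‖ ^ 2)⁻¹ • v)

theorem emb_mul_self {n : ℕ} (v : Rn n) : emb v * emb v = algebraMap ℝ (Cl n) (-‖v‖ ^ 2) := by
  rw [emb, CliffordAlgebra.ι_sq_scalar, negNormSq_apply]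

theorem emb_mul_add_swap {n : ℕ} (v w : Rn n) :
    emb v * emb w + emb w * emb v = algebraMap ℝ (Cl n) (-2 * inner ℝ v w) := by
  rw [emb, emb, CliffordAlgebra.ι_mul_ι_add_swap]
  congr 1
  rw [QuadraticMap.polar, negNormSq_apply, negNormSq_apply, negNormSq_apply,
    norm_add_sq_real]
  ring

theorem emb_mul_vinv {n : ℕ} {v : Rn n} (hv : v ≠ 0) : emb v * emb (vinv v) = 1 := by
  have h : emb (vinv v) = (-(‖v‖ ^ 2)⁻¹ : ℝ) • emb v := by
    simp [emb, vinv]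
  rw [h, mul_smul_comm, emb_mul_self, Algebra.algebraMap_eq_smul_one, smul_smul]
  have : ‖v‖ ≠ 0 := norm_ne_zero_iff.mpr hv
  have h2 : -(‖v‖ ^ 2)⁻¹ * -‖v‖ ^ 2 = (1 : ℝ) := by field_simp
  rw [h2, one_smul]

theorem vinv_mul_emb {n : ℕ} {v : Rn n} (hv : v ≠ 0) : emb (vinv v) * emb v = 1 := by
  have h : emb (vinv v) = (-(‖v‖ ^ 2)⁻¹ : ℝ) • emb v := by
    simp [emb, vinv]
  rw [← emb_mul_vinv hv, h, mul_smul_comm, smul_mul_assoc]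

/-- The Clifford algebra cross-ratio
`C(v₀, v₁, v₂, v₃) = (v₀ - v₁)(v₁ - v₂)⁻¹(v₂ - v₃)(v₃ - v₀)⁻¹`. -/
def crossRatio {n : ℕ} (v₀ v₁ v₂ v₃ : Rn n) : Cl n :=
  emb (v₀ - v₁) * emb (vinv (v₁ - v₂)) * emb (v₂ - v₃) * emb (vinv (v₃ - v₀))

/-- The points of `s` lie on a common circle or on a common straight line
(a circle through infinity). -/
def Concircular {n : ℕ} (s : Set (Rn n)) : Prop :=
  EuclideanGeometry.Concyclic s ∨ Collinear ℝ s

/-- The exterior product `α ∧ β` of two vector-valued `1`-forms at a point, coefficients being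
multiplied in the Clifford algebra. -/
def cwedge {n : ℕ} (α β : ℂ →L[ℝ] Rn n) (X Y : ℂ) : Cl n :=
  emb (α X) * emb (β Y) - emb (α Y) * emb (β X)

/-- The `(2,0)`-part of `(α, β)`: the complex bilinear extension of `(X, Y) ↦ (α X, β Y)`,
evaluated on the `(1,0)`-parts `(X - i J X) / 2` and `(Y - i J Y) / 2`, where the complex
structure `J` is multiplication by `Complex.I` on the tangent line `ℂ`. -/
def part20 {n : ℕ} (α β : ℂ →L[ℝ] Rn n) (X Y : ℂ) : ℂ :=
  (((inner ℝ (α X) (β Y) - inner ℝ (α (Complex.I * X)) (β (Complex.I * Y)) : ℝ) : ℂ)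
    - Complex.I *
      ((inner ℝ (α (Complex.I * X)) (β Y) + inner ℝ (α X) (β (Complex.I * Y)) : ℝ) : ℂ)) / 4

section Surfaces

variable {M : Type*} [TopologicalSpace M] [ChartedSpace ℂ M]

/-- The differential of `f : M → ℝⁿ` at `x`. The tangent space at `x` of a manifold modelled on
`ℂ` is `ℂ`, identified through the preferred chart at `x`; on a Riemann surface that chart is
holomorphic, so the complex structure of the tangent space is that of `ℂ`. -/
def diff {n : ℕ} (f : M → Rn n) (x : M) : ℂ →L[ℝ] Rn n :=
  mfderiv 𝓘(ℝ, ℂ) 𝓘(ℝ, Rn n) f x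

/-- A smooth map from the surface to Euclidean space. -/
def Smooth {n : ℕ} (f : M → Rn n) : Prop := ContMDiff 𝓘(ℝ, ℂ) 𝓘(ℝ, Rn n) ∞ f

/-- A (not necessarily holomorphic) quadratic differential of type `(2,0)`: at every point a
complex bilinear form on the tangent line. -/
abbrev QuadDiff (M : Type*) [TopologicalSpace M] [ChartedSpace ℂ M] : Type _ :=
  ∀ x : M, TangentSpace 𝓘(ℂ) x →L[ℂ] TangentSpace 𝓘(ℂ) x →L[ℂ] ℂ

/-- The value `Q_x(X, Y)` on tangent vectors `X`, `Y` at `x`. -/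
def QuadDiff.val (Q : QuadDiff M) (x : M) (X Y : ℂ) : ℂ := Q x X Y

/-- The tangent vector `∂/∂z` of the coordinate `z` given by the chart `e`, at the point with
coordinate `z`. -/
def coordVector (e : OpenPartialHomeomorph M ℂ) (z : ℂ) : ℂ :=
  mfderiv 𝓘(ℂ) 𝓘(ℂ) e.symm z (1 : ℂ)

/-- `Q` is holomorphic: in every chart `Q = q dz²` with `q` a holomorphic function. -/
def IsHolomorphic (Q : QuadDiff M) : Prop :=
  ∀ e ∈ atlas ℂ M,
    DifferentiableOn ℂ (fun z => Q.val (e.symm z) (coordVector e z) (coordVector e z)) e.target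

/-- `Q` is a polarisation: a holomorphic quadratic differential that is not identically zero. -/
structure IsPolarisation (Q : QuadDiff M) : Prop where
  holomorphic : IsHolomorphic Q
  nonzero : ∃ x, Q x ≠ 0

/-- `fc` is a Christoffel transform of `f` on `(M, Q)`:
`df ∧ dfᶜ = 0` and `(df, dfᶜ)^{2,0} = Q`. -/
structure IsChristoffel {n : ℕ} (Q : QuadDiff M) (f fc : M → Rn n) : Prop where
  smooth : Smooth fc
  wedge : ∀ x X Y, cwedge (diff f x) (diff fc x) X Y = 0
  part : ∀ x X Y, part20 (diff f x) (diff fc x) X Y = Q.val x X Y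

/-- `f` is an isothermic surface on the polarised Riemann surface `(M, Q)`: a smooth map which is
a conformal immersion, except possibly for branch points at the (isolated) zeros of `Q`, and which
has a Christoffel transform. Branch points are admitted since Christoffel and Darboux transforms
of an immersed isothermic surface may have them at the zeros of `Q`; if `Q` has no zeros then `f`
is a conformal immersion. -/
structure IsIsothermic {n : ℕ} (Q : QuadDiff M) (f : M → Rn n) : Prop where
  smooth : Smooth f
  immersion : ∀ x, Q x ≠ 0 → Function.Injective (diff f x)
  conformal : ∀ x, Q x ≠ 0 → ∀ X Y, part20 (diff f x) (diff f x) X Y = 0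
  christoffel : ∃ fc : M → Rn n, IsChristoffel Q f fc

/-- `fhat = 𝒟_r f`: `f` is isothermic on `(M, Q)`, and `g = fhat - f` is a nowhere zero solution
of the Riccati equation `dg = r g dfᶜ g - df`, where `fᶜ` is a Christoffel transform of `f`. -/
structure IsDarboux {n : ℕ} (Q : QuadDiff M) (r : ℝ) (f fhat : M → Rn n) : Prop where
  param_ne_zero : r ≠ 0
  isothermic : IsIsothermic Q f
  smooth : Smooth fhat
  ne : ∀ x, fhat x ≠ f x
  riccati : ∃ fc : M → Rn n, IsChristoffel Q f fc ∧ ∀ x X,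
    emb (diff (fhat - f) x X) =
      r • (emb (fhat x - f x) * emb (diff fc x X) * emb (fhat x - f x)) - emb (diff f x X)

/-- `(f, f₁, fhat, f₂)` is a Bianchi quadrilateral with parameters `r₁`, `r₂`: `f₁ = 𝒟_{r₁} f` and
`f₂ = 𝒟_{r₂} f` are distinct, `fhat` is an isothermic surface with
`fhat = 𝒟_{r₂} f₁ = 𝒟_{r₁} f₂`, and corresponding points of the four surfaces are concircular
with real cross-ratio `r₂ / r₁`. -/
structure IsBianchiQuadrilateral {n : ℕ} (Q : QuadDiff M) (r₁ r₂ : ℝ)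
    (f f₁ fhat f₂ : M → Rn n) : Prop where
  darboux₁ : IsDarboux Q r₁ f f₁
  darboux₂ : IsDarboux Q r₂ f f₂
  distinct : f₁ ≠ f₂
  isothermic : IsIsothermic Q fhat
  darboux₁₂ : IsDarboux Q r₂ f₁ fhat
  darboux₂₁ : IsDarboux Q r₁ f₂ fhat
  concircular : ∀ x, Concircular {f x, f₁ x, fhat x, f₂ x}
  crossRatio_eq : ∀ x, crossRatio (f x) (f₁ x) (fhat x) (f₂ x) = algebraMap ℝ (Cl n) (r₂ / r₁)

/-- The transform `fc + (r g)⁻¹` with `g = fhat - f`: the map that the Darboux transformation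
`f ↦ fhat` with parameter `r` induces on a Christoffel transform `fc` of `f`. -/
def induced {n : ℕ} (r : ℝ) (f fhat fc : M → Rn n) : M → Rn n :=
  fun x => fc x + vinv (r • (fhat x - f x))

end Surfaces

end

end Isothermic

namespace Isothermic

/-! The proof separates the algebra of one quadrilateral from the calculus of one edge.

Edge. With `g = f₁ - f` the Riccati equation says `df₁ = r g dfᶜ g`. Since `d(g⁻¹) = -g⁻¹ dg g⁻¹`,
the map `f₁ᶜ = fᶜ + (r g)⁻¹` satisfies `df₁ᶜ = r⁻¹ g⁻¹ df g⁻¹`. The factors `g` and `g⁻¹` cancel in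
products, so `df₁ ∧ df₁ᶜ` is conjugate to `dfᶜ ∧ df = 0` and the inner products are unchanged
(`IsDarboux.isChristoffel_induced`). The same formula is the Riccati equation for the edge `(fᶜ,
f₁ᶜ)`, with `f` as Christoffel transform of `fᶜ` (`IsDarboux.induced`). The Riccati equation holds a
priori only for some Christoffel transform. It holds for the given one because `dfᶜ` is unique:
pointwise linear algebra settles this where `Q ≠ 0`, a dense set by the identity theorem, and
continuity does the rest (`IsChristoffel.diff_eq`).

Quadrilateral. The new edges are the inverses of the scaled old ones. The cross-ratio condition
makes them close up (`induced_vertices_eq`), which is the exact coincidence of the candidates for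
`fhatᶜ`. It also passes to the new quadrilateral (`crossRatio_induced`), and a real cross-ratio
forces concircularity.

Uniqueness. A cross-ratio other than `1` determines the fourth vertex from the other three. If `r₁ =
r₂`, it forces the fourth vertex onto the first wherever the middle two differ. They differ
everywhere, because two solutions of one Riccati equation that meet at a point coincide
(`IsDarboux.eq_of_apply_eq`). -/

/-! ### Vectors in the Clifford algebra -/

theorem algebraMap_Cl_injective {n : ℕ} : Function.Injective (algebraMap ℝ (Cl n)) := by
  have : Invertible (2 : ℝ) := invertibleOfNonzero two_ne_zero
  exact FaithfulSMul.algebraMap_injective ℝ (Cl n)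

theorem emb_eq_zero {n : ℕ} {v : Rn n} : emb v = 0 ↔ v = 0 := by
  refine ⟨fun h => ?_, fun h => by rw [h]; exact map_zero _⟩
  have e := emb_mul_self v
  rw [h, mul_zero, ← map_zero (algebraMap ℝ (Cl n))] at e
  simpa using algebraMap_Cl_injective e

theorem emb_add {n : ℕ} (v w : Rn n) : emb (v + w) = emb v + emb w := map_add _ v w

theorem emb_sub {n : ℕ} (v w : Rn n) : emb (v - w) = emb v - emb w := map_sub _ v w

theorem emb_neg {n : ℕ} (v : Rn n) : emb (-v) = -emb v := map_neg _ v

theorem emb_smul {n : ℕ} (t : ℝ) (v : Rn n) : emb (t • v) = t • emb v := map_smul _ t v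

@[simp] theorem emb_zero {n : ℕ} : emb (0 : Rn n) = 0 := map_zero _

theorem emb_injective {n : ℕ} : Function.Injective (emb : Rn n → Cl n) := by
  intro v w h
  rw [← sub_eq_zero, ← emb_eq_zero, emb_sub, h, sub_self]

theorem emb_mul_self_smul {n : ℕ} (v : Rn n) : emb v * emb v = (-‖v‖ ^ 2) • (1 : Cl n) := by
  rw [emb_mul_self, Algebra.algebraMap_eq_smul_one]

theorem emb_mul_swap {n : ℕ} (v w : Rn n) :
    emb v * emb w = (-2 * inner ℝ v w) • (1 : Cl n) - emb w * emb v := by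
  rw [← Algebra.algebraMap_eq_smul_one, ← emb_mul_add_swap, add_sub_cancel_right]

theorem reverse_emb {n : ℕ} (v : Rn n) : CliffordAlgebra.reverse (emb v) = emb v :=
  CliffordAlgebra.reverse_ι v

theorem smul_one_injective {n : ℕ} {s t : ℝ} (h : s • (1 : Cl n) = t • (1 : Cl n)) : s = t :=
  algebraMap_Cl_injective (by simpa only [Algebra.algebraMap_eq_smul_one] using h)

theorem inner_eq_of_emb {n : ℕ} {v w v' w' : Rn n}
    (h : emb v * emb w + emb w * emb v = emb v' * emb w' + emb w' * emb v') :
    (inner ℝ v w : ℝ) = inner ℝ v' w' := by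
  rw [emb_mul_add_swap, emb_mul_add_swap] at h
  have := algebraMap_Cl_injective h
  linarith

theorem inner_eq_zero_of_emb {n : ℕ} {v w : Rn n} (h : emb v * emb w + emb w * emb v = 0) :
    (inner ℝ v w : ℝ) = 0 := by
  simpa using inner_eq_of_emb (v' := (0 : Rn n)) (w' := 0) (by simpa using h)

theorem emb_mul_eq_zero {n : ℕ} {v w : Rn n} (h : emb v * emb w = 0) : v = 0 ∨ w = 0 := by
  by_contra! hc
  have : emb (vinv v) * (emb v * emb w) = emb w := by
    rw [← mul_assoc, vinv_mul_emb hc.1, one_mul]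
  rw [h, mul_zero] at this
  exact hc.2 (emb_eq_zero.1 this.symm)

/-- The sandwich product `v w v` of vectors, as a vector. -/
noncomputable def sandwich {n : ℕ} (v w : Rn n) : Rn n :=
  ‖v‖ ^ 2 • w - (2 * inner ℝ v w : ℝ) • v

theorem emb_sandwich {n : ℕ} (v w : Rn n) : emb (sandwich v w) = emb v * emb w * emb v := by
  rw [sandwich, emb_sub, emb_smul, emb_smul, emb_mul_swap v w, sub_mul, mul_assoc,
    emb_mul_self_smul, mul_smul_comm, mul_one, smul_mul_assoc, one_mul]
  module

theorem vinv_ne_zero {n : ℕ} {v : Rn n} (hv : v ≠ 0) : vinv v ≠ 0 := by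
  simpa [vinv] using hv

theorem eq_vinv_of_emb_mul {n : ℕ} {v w : Rn n} (h : emb v * emb w = 1) : v = vinv w := by
  have hw : w ≠ 0 := by
    rintro rfl
    rw [emb_zero, mul_zero] at h
    exact zero_ne_one (smul_one_injective (n := n) (s := 0) (t := 1)
      (by rw [zero_smul, one_smul, h]))
  apply emb_injective
  calc emb v = emb v * (emb w * emb (vinv w)) := by rw [emb_mul_vinv hw, mul_one]
    _ = emb (vinv w) := by rw [← mul_assoc, h, one_mul]

theorem vinv_vinv {n : ℕ} {v : Rn n} (hv : v ≠ 0) : vinv (vinv v) = v :=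
  (eq_vinv_of_emb_mul (emb_mul_vinv hv)).symm

theorem vinv_smul {n : ℕ} (t : ℝ) (v : Rn n) : vinv (t • v) = t⁻¹ • vinv v := by
  by_cases ht : t = 0
  · simp [ht, vinv]
  · rw [vinv, vinv, norm_smul, smul_neg, smul_smul, smul_smul, mul_pow, Real.norm_eq_abs, sq_abs]
    congr 2
    field_simp

theorem vinv_neg {n : ℕ} (v : Rn n) : vinv (-v) = -vinv v := by simp [vinv]

theorem sandwich_smul_left {n : ℕ} (t : ℝ) (v w : Rn n) :
    sandwich (t • v) w = t ^ 2 • sandwich v w := by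
  apply emb_injective
  simp only [emb_sandwich, emb_smul, smul_mul_assoc, mul_smul_comm, smul_smul, pow_two]

theorem sandwich_sandwich_vinv {n : ℕ} {v : Rn n} (hv : v ≠ 0) (w : Rn n) :
    sandwich (vinv v) (sandwich v w) = w := by
  apply emb_injective
  rw [emb_sandwich, emb_sandwich]
  calc _ = (emb (vinv v) * emb v) * emb w * (emb v * emb (vinv v)) := by noncomm_ring
    _ = _ := by rw [vinv_mul_emb hv, emb_mul_vinv hv, one_mul, mul_one]

theorem sandwich_sub {n : ℕ} (v w w' : Rn n) :
    sandwich v (w - w') = sandwich v w - sandwich v w' := by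
  apply emb_injective
  simp only [emb_sandwich, emb_sub, mul_sub, sub_mul]

theorem sandwich_smul {n : ℕ} (t : ℝ) (v w : Rn n) :
    sandwich v (t • w) = t • sandwich v w := by
  apply emb_injective
  simp only [emb_sandwich, emb_smul, smul_mul_assoc, mul_smul_comm]

/-- The inner factors `v` and `v⁻¹` cancel. This is why the wedge condition survives a Darboux
transformation. -/
theorem emb_sandwich_mul_sandwich_vinv {n : ℕ} {v : Rn n} (hv : v ≠ 0) (w w' : Rn n) :
    emb (sandwich v w) * emb (sandwich (vinv v) w') = emb v * (emb w * emb w') * emb (vinv v) := by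
  rw [emb_sandwich, emb_sandwich]
  calc _ = emb v * emb w * (emb v * emb (vinv v)) * emb w' * emb (vinv v) := by noncomm_ring
    _ = _ := by rw [emb_mul_vinv hv]; noncomm_ring

theorem inner_sandwich_sandwich_vinv {n : ℕ} {v : Rn n} (hv : v ≠ 0) (w w' : Rn n) :
    (inner ℝ (sandwich v w) (sandwich (vinv v) w') : ℝ) = inner ℝ w w' := by
  have hv' : ‖v‖ ≠ 0 := norm_ne_zero_iff.2 hv
  simp only [sandwich, vinv, inner_sub_left, inner_sub_right, inner_smul_left, inner_smul_right,
    norm_neg, norm_smul, inner_neg_left, inner_neg_right, real_inner_self_eq_norm_sq,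
    norm_inv, norm_pow, norm_norm, real_inner_comm v w, RCLike.conj_to_real]
  field_simp
  ring

/-! ### Linear algebra of the Christoffel condition at a point -/

section PointwiseChristoffel

variable {n : ℕ} {a b p q : Rn n}

theorem emb_mul_eq_reverse (h : emb a * emb q = emb b * emb p) :
    emb q * emb a = emb p * emb b := by
  simpa only [CliffordAlgebra.reverse.map_mul, reverse_emb] using
    congrArg CliffordAlgebra.reverse h

theorem emb_mul_swap_of_inner_eq_zero (h : (inner ℝ a b : ℝ) = 0) :
    emb a * emb b = -(emb b * emb a) := by
  rw [emb_mul_swap, h]; simp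

/-- Here and below `a, b` stand for the values of `df` on `1, i` and `p, q` for those of `dfᶜ`, so
that `a q = b p` is `df ∧ dfᶜ = 0`. Multiplying it by its reversal makes both sides scalar. -/
theorem norm_eq_of_emb_mul_eq (ha : a ≠ 0) (hab : ‖a‖ = ‖b‖)
    (h : emb a * emb q = emb b * emb p) : ‖p‖ = ‖q‖ := by
  have h' := emb_mul_eq_reverse h
  have ha' : ‖a‖ ≠ 0 := norm_ne_zero_iff.2 ha
  have e : emb q * (emb a * emb a) * emb q = emb p * (emb b * emb b) * emb p := by
    calc _ = (emb q * emb a) * (emb a * emb q) := by noncomm_ring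
      _ = _ := by rw [h, h']; noncomm_ring
  simp only [emb_mul_self_smul, mul_smul_comm, smul_mul_assoc, mul_one, smul_smul] at e
  have e2 := smul_one_injective e
  rw [← hab] at e2
  have : ‖q‖ ^ 2 = ‖p‖ ^ 2 := by
    have : ‖a‖ ^ 2 * (‖q‖ ^ 2 - ‖p‖ ^ 2) = 0 := by linarith
    rcases mul_eq_zero.1 this with h | h
    · exact absurd h (pow_ne_zero _ ha')
    · linarith
  exact (pow_left_inj₀ (norm_nonneg _) (norm_nonneg _) two_ne_zero).1 this.symm

theorem inner_eq_zero_of_emb_mul_eq (ha : a ≠ 0) (horth : (inner ℝ a b : ℝ) = 0)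
    (h : emb a * emb q = emb b * emb p) : (inner ℝ p q : ℝ) = 0 := by
  have h' := emb_mul_eq_reverse h
  have hs := emb_mul_swap_of_inner_eq_zero horth
  have ha' : -‖a‖ ^ 2 ≠ 0 := by simpa using ha
  apply inner_eq_zero_of_emb
  have e : emb p * (emb a * emb a) * emb q + emb q * (emb a * emb a) * emb p = 0 := by
    calc _ = emb p * emb a * (emb a * emb q) + (emb q * emb a) * emb a * emb p := by noncomm_ring
      _ = emb p * (emb a * emb b) * emb p + emb p * (emb b * emb a) * emb p := by
        rw [h, h']; noncomm_ring
      _ = 0 := by rw [hs]; noncomm_ring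
  simp only [emb_mul_self_smul, mul_smul_comm, smul_mul_assoc, mul_one, ← smul_add] at e
  exact (smul_eq_zero.1 e).resolve_left ha'

/-- Infinitesimal uniqueness: `p, q` will be the difference of two Christoffel differentials, and
`h₁`, `h₂` say that its `(2,0)`-part against `df` vanishes. All of `a, b, q` turn out to anticommute
with `p`, which is incompatible with `a q = b p` unless `p = 0`. -/
theorem eq_zero_of_emb_mul_eq (ha : a ≠ 0) (hab : ‖a‖ = ‖b‖) (horth : (inner ℝ a b : ℝ) = 0)
    (h : emb a * emb q = emb b * emb p) (h₁ : (inner ℝ a p : ℝ) = inner ℝ b q)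
    (h₂ : (inner ℝ b p : ℝ) = -inner ℝ a q) : p = 0 ∧ q = 0 := by
  have h' := emb_mul_eq_reverse h
  have hs := emb_mul_swap_of_inner_eq_zero horth
  have hn := norm_eq_of_emb_mul_eq ha hab h
  have hpq := emb_mul_swap_of_inner_eq_zero (inner_eq_zero_of_emb_mul_eq ha horth h)
  have hb : b ≠ 0 := by rw [← norm_ne_zero_iff, ← hab]; exact norm_ne_zero_iff.2 ha
  have ha' : -‖a‖ ^ 2 ≠ 0 := by simpa using ha
  have e₁ : (inner ℝ a q : ℝ) = inner ℝ b p := inner_eq_of_emb (by rw [h, h'])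
  have hbp : (inner ℝ b p : ℝ) = 0 := by linarith
  -- Since `‖a‖ = ‖b‖`, this amounts to `(b, q) = -(a, p)`; with `h₁` both vanish.
  have e₂ : emb b * (emb a * emb a) * emb q + emb q * (emb a * emb a) * emb b
      = emb a * (-(emb b * emb b)) * emb p + emb p * (-(emb b * emb b)) * emb a := by
    calc _ = (emb b * emb a) * (emb a * emb q) + (emb q * emb a) * (emb a * emb b) := by
          noncomm_ring
      _ = (emb b * emb a) * (emb b * emb p) + (emb p * emb b) * (-(emb b * emb a)) := by
          rw [h, h', hs]
      _ = -((-(emb b * emb a)) * emb b * emb p) - (emb p * emb b) * (emb b * emb a) := by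
          noncomm_ring
      _ = _ := by rw [← hs]; noncomm_ring
  simp only [emb_mul_self_smul, ← hab, mul_smul_comm, smul_mul_assoc, mul_one, ← smul_add,
    ← smul_neg, mul_neg, neg_mul] at e₂
  have hap : (inner ℝ a p : ℝ) = 0 := by
    have : (inner ℝ b q : ℝ) = inner ℝ a (-p) := by
      apply inner_eq_of_emb
      apply smul_right_injective _ ha'
      simp only [emb_neg, mul_neg, neg_mul]
      rw [e₂]
    rw [inner_neg_right] at this
    linarith
  have sap := emb_mul_swap_of_inner_eq_zero hap
  have sbp := emb_mul_swap_of_inner_eq_zero hbp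
  -- Anticommuting with `a` and `q`, `p` commutes with `a q = b p`; anticommuting with `b`, it then
  -- satisfies `b p² = -b p²`.
  have e₃ : emb p * (emb a * emb q) = (emb a * emb q) * emb p := by
    calc _ = -(-(emb p * emb a)) * emb q := by noncomm_ring
      _ = -(emb a * (emb p * emb q)) := by rw [← sap]; noncomm_ring
      _ = _ := by rw [hpq]; noncomm_ring
  rw [h] at e₃
  have e₄ : -(emb b * (emb p * emb p)) = emb b * (emb p * emb p) := by
    calc _ = -(emb b * emb p) * emb p := by noncomm_ring
      _ = emb p * (emb b * emb p) := by nth_rewrite 1 [sbp]; rw [neg_neg, mul_assoc]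
      _ = _ := by rw [e₃, mul_assoc]
  rw [emb_mul_self_smul, mul_smul_comm, mul_one, ← smul_neg, ← emb_neg, ← emb_smul,
    ← emb_smul] at e₄
  have e₅ := emb_injective e₄
  have hp : p = 0 := by
    by_contra hp
    have : -‖p‖ ^ 2 ≠ 0 := by simpa using hp
    have := smul_right_injective _ this e₅
    beta_reduce at this
    have h2 : (2 : ℝ) • b = 0 := by rw [two_smul]; nth_rewrite 1 [← this]; exact neg_add_cancel b
    exact hb ((smul_eq_zero.1 h2).resolve_left two_ne_zero)
  refine ⟨hp, ?_⟩
  rw [← norm_eq_zero, ← hn, hp, norm_zero]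

end PointwiseChristoffel

/-! ### Noncommutative cross-ratio identities -/

section RingIdentities

variable {R : Type*} [Ring R] [Algebra ℝ R] {A A' B B' D D' E E' : R}

/-- The two paths `A, B` and `D, E` run along the sides from the first vertex to the opposite one;
primes are inverses. The cross-ratio condition is `E D' = c B A'`, so the terms `B A'` and `c⁻¹ E
D'` cancel. -/
theorem quad_diagonal_mul {c : ℝ} (hc : c ≠ 0) (hA : A * A' = 1)
    (hB : B * B' = 1) (hA' : A' * A = 1) (hD : D * D' = 1) (hsum : A + B = D + E)
    (hx : A * B' * E * D' = c • (1 : R)) :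
    (A + B) * (A' - c⁻¹ • D') = (1 - c⁻¹) • (1 : R) := by
  have e : E * D' = c • (B * A') := by
    calc E * D' = B * (A' * A) * B' * E * D' := by rw [hA', mul_one, hB, one_mul]
      _ = B * A' * (A * B' * E * D') := by noncomm_ring
      _ = _ := by rw [hx, mul_smul_comm, mul_one]
  have e' : B * A' = c⁻¹ • (E * D') := by rw [e, smul_smul, inv_mul_cancel₀ hc, one_smul]
  calc _ = A * A' + B * A' - c⁻¹ • ((D + E) * D') := by
        rw [mul_sub, mul_smul_comm, ← hsum, add_mul]
    _ = _ := by rw [e', hA, add_mul, hD]; module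

/-- Closing of the dual quadrilateral, multiplied by `r₁ r₂` and by the diagonal. Expanding the
diagonal as `A + B` or `D + E` leaves mixed terms, which cancel in pairs: `r₁ D' E = r₂ A' B` and
`r₁ B' A = r₂ E' D`. -/
theorem quad_sum_mul_diagonal {r₁ r₂ : ℝ} (h₁ : r₁ ≠ 0)
    (hA' : A' * A = 1) (hA : A * A' = 1) (hB' : B' * B = 1)
    (hD' : D' * D = 1) (hD : D * D' = 1) (hE' : E' * E = 1) (hsum : A + B = D + E)
    (hx : D' * E * B' * A = (r₂ / r₁) • (1 : R)) :
    (r₂ • A' + r₁ • B' - (r₁ • D' + r₂ • E')) * (A + B) = 0 := by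
  have e₁ : D' * E = (r₂ / r₁) • (A' * B) := by
    calc D' * E = D' * E * (B' * (A * A') * B) := by rw [hA, mul_one, hB', mul_one]
      _ = (D' * E * B' * A) * (A' * B) := by noncomm_ring
      _ = _ := by rw [hx, smul_mul_assoc, one_mul]
  have e₂ : B' * A = (r₂ / r₁) • (E' * D) := by
    calc B' * A = E' * (D * D') * E * B' * A := by rw [hD, mul_one, hE', one_mul]
      _ = (E' * D) * (D' * E * B' * A) := by noncomm_ring
      _ = _ := by rw [hx, mul_smul_comm, mul_one]
  calc _ = r₂ • (A' * A) + r₂ • (A' * B) + r₁ • (B' * A) + r₁ • (B' * B)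
        - (r₁ • D' + r₂ • E') * (D + E) := by
        rw [sub_mul, hsum, ← hsum]; simp only [add_mul, mul_add, smul_mul_assoc]; abel
    _ = r₂ • (A' * B) + r₁ • (B' * A) - (r₁ • (D' * E) + r₂ • (E' * D)) := by
        simp only [add_mul, mul_add, smul_mul_assoc, hA', hB', hD', hE']; abel
    _ = 0 := by
        rw [e₁, e₂, smul_smul, smul_smul, mul_div_cancel₀ _ h₁]; abel

theorem quad_inverse_crossRatio {c : ℝ} (hc : c ≠ 0) (hA' : A' * A = 1) (hB : B * B' = 1)
    (hE' : E' * E = 1) (hD : D * D' = 1) (hx : D' * E * B' * A = c • (1 : R)) :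
    A' * B * E' * D = c⁻¹ • (1 : R) := by
  have : A' * B * E' * D * (D' * E * B' * A) = 1 := by
    calc _ = A' * B * (E' * (D * D') * E) * B' * A := by noncomm_ring
      _ = 1 := by rw [hD, mul_one, hE', mul_one, mul_assoc A', hB, mul_one, hA']
  rw [hx, mul_smul_comm, mul_one] at this
  rw [← this, smul_smul, inv_mul_cancel₀ hc, one_smul]

end RingIdentities

/-! ### Quadrilaterals with real cross-ratio -/

section Quadrilateral

variable {n : ℕ} {v₀ v₁ w v₂ : Rn n}

theorem crossRatio_eq_mul :
    crossRatio v₀ v₁ w v₂ =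
      emb (v₁ - v₀) * emb (vinv (w - v₁)) * emb (w - v₂) * emb (vinv (v₂ - v₀)) := by
  rw [crossRatio, ← neg_sub v₁ v₀, ← neg_sub w v₁, vinv_neg, emb_neg, emb_neg, neg_mul_neg]

theorem crossRatio_reverse {c : ℝ} (h : crossRatio v₀ v₁ w v₂ = algebraMap ℝ (Cl n) c) :
    emb (vinv (v₂ - v₀)) * emb (w - v₂) * emb (vinv (w - v₁)) * emb (v₁ - v₀) =
      c • (1 : Cl n) := by
  rw [crossRatio_eq_mul] at h
  have := congrArg CliffordAlgebra.reverse h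
  rw [CliffordAlgebra.reverse.commutes, Algebra.algebraMap_eq_smul_one] at this
  simpa only [CliffordAlgebra.reverse.map_mul, reverse_emb, mul_assoc] using this

theorem emb_add_edges : emb (v₁ - v₀) + emb (w - v₁) = emb (v₂ - v₀) + emb (w - v₂) := by
  simp only [emb_sub]; abel

theorem diagonal_mul_of_crossRatio {c : ℝ} (hc : c ≠ 0) (h₁ : v₁ ≠ v₀) (h₂ : v₂ ≠ v₀)
    (h₁₂ : w ≠ v₁) (h : crossRatio v₀ v₁ w v₂ = algebraMap ℝ (Cl n) c) :
    emb (w - v₀) * emb (vinv (v₁ - v₀) - c⁻¹ • vinv (v₂ - v₀)) = (1 - c⁻¹) • (1 : Cl n) := by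
  rw [crossRatio_eq_mul, Algebra.algebraMap_eq_smul_one] at h
  rw [← sub_ne_zero] at h₁ h₂ h₁₂
  have := quad_diagonal_mul hc (emb_mul_vinv h₁) (emb_mul_vinv h₁₂)
    (vinv_mul_emb h₁) (emb_mul_vinv h₂) emb_add_edges h
  rw [emb_sub (vinv _), emb_smul, ← this]
  congr 1
  rw [← emb_add]; congr 1; abel

/-- The fourth vertex of a quadrilateral with cross-ratio `c ≠ 1`. -/
theorem diagonal_eq_of_crossRatio {c : ℝ} (hc : c ≠ 0) (hc₁ : c ≠ 1) (h₁ : v₁ ≠ v₀)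
    (h₂ : v₂ ≠ v₀) (h₁₂ : w ≠ v₁) (h : crossRatio v₀ v₁ w v₂ = algebraMap ℝ (Cl n) c) :
    vinv (v₁ - v₀) - c⁻¹ • vinv (v₂ - v₀) ≠ 0 ∧
      w - v₀ = (1 - c⁻¹) • vinv (vinv (v₁ - v₀) - c⁻¹ • vinv (v₂ - v₀)) := by
  have key := diagonal_mul_of_crossRatio hc h₁ h₂ h₁₂ h
  set y := vinv (v₁ - v₀) - c⁻¹ • vinv (v₂ - v₀)
  have ht : 1 - c⁻¹ ≠ 0 := by
    rw [sub_ne_zero]; intro h; exact hc₁ (by rw [← inv_inv c, ← h, inv_one])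
  have hy : y ≠ 0 := by
    intro hy
    rw [hy, emb_zero, mul_zero] at key
    exact ht (smul_one_injective (n := n) (by rw [← key, zero_smul]))
  refine ⟨hy, ?_⟩
  have : emb ((1 - c⁻¹)⁻¹ • (w - v₀)) * emb y = 1 := by
    rw [emb_smul, smul_mul_assoc, key, smul_smul, inv_mul_cancel₀ ht, one_smul]
  rw [← eq_vinv_of_emb_mul this, smul_smul, mul_inv_cancel₀ ht, one_smul]

theorem eq_or_eq_of_crossRatio_one (h₁ : v₁ ≠ v₀) (h₂ : v₂ ≠ v₀) (h₁₂ : w ≠ v₁)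
    (h : crossRatio v₀ v₁ w v₂ = algebraMap ℝ (Cl n) 1) : w = v₀ ∨ v₁ = v₂ := by
  have key := diagonal_mul_of_crossRatio one_ne_zero h₁ h₂ h₁₂ h
  rw [inv_one, sub_self, zero_smul, one_smul] at key
  rcases emb_mul_eq_zero key with h | h
  · exact .inl (sub_eq_zero.1 h)
  · right
    have := congrArg vinv (sub_eq_zero.1 h)
    rw [vinv_vinv (sub_ne_zero.2 h₁), vinv_vinv (sub_ne_zero.2 h₂)] at this
    exact sub_left_injective this

theorem induced_vertices_eq {r₁ r₂ : ℝ} (hr₁ : r₁ ≠ 0) (hr₂ : r₂ ≠ 0) (h₁ : v₁ ≠ v₀) (h₂ : v₂ ≠ v₀)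
    (h₁₂ : w ≠ v₁) (h₂₁ : w ≠ v₂)
    (h : crossRatio v₀ v₁ w v₂ = algebraMap ℝ (Cl n) (r₂ / r₁)) :
    vinv (r₁ • (v₁ - v₀)) + vinv (r₂ • (w - v₁)) =
      vinv (r₂ • (v₂ - v₀)) + vinv (r₁ • (w - v₂)) := by
  have hrev := crossRatio_reverse h
  simp only [vinv_smul]
  rw [← sub_ne_zero] at h₁ h₂ h₁₂ h₂₁
  have key := quad_sum_mul_diagonal hr₁ (vinv_mul_emb h₁) (emb_mul_vinv h₁)
    (vinv_mul_emb h₁₂) (vinv_mul_emb h₂) (emb_mul_vinv h₂) (vinv_mul_emb h₂₁)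
    emb_add_edges hrev
  have hsum : (v₁ - v₀) + (w - v₁) = w - v₀ := by abel
  rw [← emb_add, hsum] at key
  simp only [← emb_smul, ← emb_add, ← emb_sub] at key
  rcases emb_mul_eq_zero key with hz | hz
  · have := congrArg (fun u => (r₁ * r₂)⁻¹ • u) (sub_eq_zero.1 hz)
    simp only [smul_add, smul_smul] at this
    have e₁ : (r₁ * r₂)⁻¹ * r₂ = r₁⁻¹ := by field_simp
    have e₂ : (r₁ * r₂)⁻¹ * r₁ = r₂⁻¹ := by field_simp
    rwa [e₁, e₂] at this
  -- A vanishing diagonal means `w = v₀`; then the cross-ratio is `1`, so `r₁ = r₂` and both sums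
  -- are zero.
  · rw [sub_eq_zero] at hz
    subst hz
    rw [← neg_sub v₁ w, ← neg_sub v₂ w] at hrev ⊢
    rw [vinv_neg, emb_neg, emb_neg, mul_neg, mul_neg, neg_mul, neg_mul, neg_mul, neg_neg,
      vinv_mul_emb h₂, one_mul, vinv_mul_emb h₁] at hrev
    have : r₁ = r₂ := by
      have := smul_one_injective (n := n) (s := 1) (t := r₂ / r₁) ((one_smul ℝ (1 : Cl n)).trans hrev)
      field_simp at this; exact this
    rw [this, vinv_neg, vinv_neg, smul_neg, smul_neg, add_neg_cancel, add_neg_cancel]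

/-- Inverting all edges turns the reversed cross-ratio `r₂ / r₁` into its inverse, and the scalings
of the edges contribute `(r₂ / r₁)²`. -/
theorem crossRatio_induced {r₁ r₂ : ℝ} (hr₁ : r₁ ≠ 0) (hr₂ : r₂ ≠ 0)
    (h₁ : v₁ ≠ v₀) (h₂ : v₂ ≠ v₀) (h₁₂ : w ≠ v₁) (h₂₁ : w ≠ v₂)
    (h : crossRatio v₀ v₁ w v₂ = algebraMap ℝ (Cl n) (r₂ / r₁)) {u₀ u₁ u u₂ : Rn n}
    (hu₁ : u₁ - u₀ = vinv (r₁ • (v₁ - v₀))) (hu₂ : u₂ - u₀ = vinv (r₂ • (v₂ - v₀)))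
    (hu₁₂ : u - u₁ = vinv (r₂ • (w - v₁))) (hu₂₁ : u - u₂ = vinv (r₁ • (w - v₂))) :
    crossRatio u₀ u₁ u u₂ = algebraMap ℝ (Cl n) (r₂ / r₁) := by
  have hrev := crossRatio_reverse h
  rw [← sub_ne_zero] at h₁ h₂ h₁₂ h₂₁
  have key := quad_inverse_crossRatio (div_ne_zero hr₂ hr₁) (vinv_mul_emb h₁) (emb_mul_vinv h₁₂)
    (vinv_mul_emb h₂₁) (emb_mul_vinv h₂) hrev
  rw [crossRatio_eq_mul, hu₁, hu₂, hu₁₂, hu₂₁, vinv_vinv (smul_ne_zero hr₂ h₁₂),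
    vinv_vinv (smul_ne_zero hr₂ h₂), vinv_smul, vinv_smul]
  simp only [emb_smul, smul_mul_assoc, mul_smul_comm, smul_smul]
  rw [key, smul_smul, Algebra.algebraMap_eq_smul_one]
  congr 1
  field_simp

theorem coplanar_of_mem_span_pair {p x y : Rn n} {s : Set (Rn n)} (hp : p ∈ s)
    (h : ∀ q ∈ s, q - p ∈ Submodule.span ℝ {x, y}) : Coplanar ℝ s := by
  have hle : vectorSpan ℝ s ≤ Submodule.span ℝ {x, y} := by
    rw [vectorSpan_eq_span_vsub_set_right ℝ hp, Submodule.span_le]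
    rintro _ ⟨q, hq, rfl⟩
    exact h q hq
  rw [coplanar_iff_finrank_le_two]
  classical
  have h2 := finrank_span_finset_le_card (R := ℝ) ({x, y} : Finset (Rn n))
  rw [Finset.coe_pair] at h2
  exact (Submodule.finrank_mono hle).trans (h2.trans Finset.card_le_two)

theorem vinv_mem {S : Submodule ℝ (Rn n)} {v : Rn n} (h : v ∈ S) : vinv v ∈ S :=
  S.neg_mem (S.smul_mem _ h)

theorem norm_vinv_sub_eq {x m : Rn n} (hx : x ≠ 0) (h : (inner ℝ x m : ℝ) = -(1 / 2)) :
    ‖vinv x - m‖ = ‖m‖ := by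
  have hx' : ‖x‖ ≠ 0 := norm_ne_zero_iff.2 hx
  rw [← pow_left_inj₀ (norm_nonneg _) (norm_nonneg _) two_ne_zero, norm_sub_sq_real, vinv,
    inner_neg_left, inner_smul_left, h, norm_neg, norm_smul]
  simp
  field_simp
  ring

/-- Inversion at `p` maps a line to a circle or line through `p`. -/
theorem concircular_inversion {p x y z : Rn n} (hx : x ≠ 0) (hy : y ≠ 0) (hz : z ≠ 0) {s : ℝ}
    (h : z = x + s • (y - x)) :
    Concircular {p, p + vinv x, p + vinv z, p + vinv y} := by
  have hp : p ∈ ({p, p + vinv x, p + vinv z, p + vinv y} : Set (Rn n)) := by simp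
  set k := y - x
  -- `x - t • k` is the foot of the perpendicular from the origin to the line through `x` and `y`.
  -- If `k = 0`, division by zero gives `t = 0` and the foot is `x`.
  set t : ℝ := inner ℝ x k / ‖k‖ ^ 2
  by_cases hm : x - t • k = 0
  · right
    rw [collinear_iff_of_mem hp]
    have hxk : x = t • k := sub_eq_zero.1 hm
    have hyk : y = (t + 1) • k := by rw [add_smul, ← hxk, one_smul]; simp [k]
    have hzk : z = (t + s) • k := by rw [add_smul, ← hxk, h]
    refine ⟨vinv k, ?_⟩
    rintro q (rfl | rfl | rfl | rfl)
    · exact ⟨0, by simp⟩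
    · exact ⟨t⁻¹, by rw [hxk, vinv_smul, vadd_eq_add, add_comm]⟩
    · exact ⟨(t + s)⁻¹, by rw [hzk, vinv_smul, vadd_eq_add, add_comm]⟩
    · exact ⟨(t + 1)⁻¹, by rw [hyk, vinv_smul, vadd_eq_add, add_comm]⟩
  · left
    set w := x - t • k
    have hw : ‖w‖ ^ 2 ≠ 0 := pow_ne_zero _ (norm_ne_zero_iff.2 hm)
    have hkw : (inner ℝ k w : ℝ) = 0 := by
      by_cases hk : k = 0
      · rw [hk, inner_zero_left]
      have : ‖k‖ ≠ 0 := norm_ne_zero_iff.2 hk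
      simp only [w, t, inner_sub_right, inner_smul_right, real_inner_self_eq_norm_sq,
        real_inner_comm k x]
      field_simp
      simp
    have hxw : (inner ℝ x w : ℝ) = ‖w‖ ^ 2 := by
      have : x = w + t • k := by simp [w]
      rw [this, inner_add_left, inner_smul_left, hkw, real_inner_self_eq_norm_sq]
      simp
    -- Half of `vinv w`, the image of the foot: the image circle has the segment from `0` to `vinv
    -- w` as a diameter.
    set m := (-(1 / 2) * (‖w‖ ^ 2)⁻¹) • w
    have hxm : (inner ℝ x m : ℝ) = -(1 / 2) := by
      rw [inner_smul_right, hxw, mul_assoc, inv_mul_cancel₀ hw, mul_one]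
    have hkm : (inner ℝ k m : ℝ) = 0 := by rw [inner_smul_right, hkw, mul_zero]
    have hym : (inner ℝ y m : ℝ) = -(1 / 2) := by
      have : y = x + k := by simp [k]
      rw [this, inner_add_left, hkm, hxm, add_zero]
    have hzm : (inner ℝ z m : ℝ) = -(1 / 2) := by
      rw [h, inner_add_left, inner_smul_left, hkm, hxm, mul_zero, add_zero]
    refine ⟨⟨p + m, ‖m‖, ?_⟩, coplanar_of_mem_span_pair (x := x) (y := y) hp ?_⟩
    · rintro q (rfl | rfl | rfl | rfl)
      · simp
      · rw [dist_add_left, dist_eq_norm, norm_vinv_sub_eq hx hxm]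
      · rw [dist_add_left, dist_eq_norm, norm_vinv_sub_eq hz hzm]
      · rw [dist_add_left, dist_eq_norm, norm_vinv_sub_eq hy hym]
    · have mx : x ∈ Submodule.span ℝ {x, y} := Submodule.subset_span (by simp)
      have my : y ∈ Submodule.span ℝ {x, y} := Submodule.subset_span (by simp)
      have mz : z ∈ Submodule.span ℝ {x, y} := by
        rw [h]; exact add_mem mx (Submodule.smul_mem _ _ (sub_mem my mx))
      rintro q (rfl | rfl | rfl | rfl)
      · simp
      · rw [add_sub_cancel_left]; exact vinv_mem mx
      · rw [add_sub_cancel_left]; exact vinv_mem mz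
      · rw [add_sub_cancel_left]; exact vinv_mem my

/-- Four points with real cross-ratio are concircular. -/
theorem concircular_of_crossRatio {c : ℝ} (hc : c ≠ 0) (h₁ : v₁ ≠ v₀) (h₂ : v₂ ≠ v₀)
    (h₁₂ : w ≠ v₁) (h : crossRatio v₀ v₁ w v₂ = algebraMap ℝ (Cl n) c) :
    Concircular {v₀, v₁, w, v₂} := by
  have h₁' := sub_ne_zero.2 h₁
  have h₂' := sub_ne_zero.2 h₂
  have e₁ : v₀ + vinv (vinv (v₁ - v₀)) = v₁ := by rw [vinv_vinv h₁', add_sub_cancel]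
  have e₂ : v₀ + vinv (vinv (v₂ - v₀)) = v₂ := by rw [vinv_vinv h₂', add_sub_cancel]
  -- For `c = 1` at most three of the points are distinct, and `s = 0` repeats one of them.
  by_cases hc₁ : c = 1
  · subst hc₁
    rcases eq_or_eq_of_crossRatio_one h₁ h₂ h₁₂ h with rfl | rfl
    · have := concircular_inversion (p := w) (vinv_ne_zero h₁') (vinv_ne_zero h₂')
        (vinv_ne_zero h₁') (s := 0) (by simp)
      rw [e₁, e₂] at this
      convert this using 1
      ext q; simp; tauto
    · by_cases hw : w = v₀
      · subst hw
        have := concircular_inversion (p := w) (vinv_ne_zero h₁') (vinv_ne_zero h₁')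
          (vinv_ne_zero h₁') (s := 0) (by simp)
        rw [e₁] at this
        convert this using 1
        ext q; simp
      · have hw' := sub_ne_zero.2 hw
        have ew : v₀ + vinv (vinv (w - v₀)) = w := by rw [vinv_vinv hw', add_sub_cancel]
        have := concircular_inversion (p := v₀) (vinv_ne_zero h₁') (vinv_ne_zero hw')
          (vinv_ne_zero h₁') (s := 0) (by simp)
        rw [e₁, ew] at this
        convert this using 1
        ext q; simp; tauto
  · obtain ⟨hy, hw⟩ := diagonal_eq_of_crossRatio hc hc₁ h₁ h₂ h₁₂ h
    set y := vinv (v₁ - v₀) - c⁻¹ • vinv (v₂ - v₀)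
    have ht : 1 - c⁻¹ ≠ 0 := by
      rw [sub_ne_zero]; intro h; exact hc₁ (by rw [← inv_inv c, ← h, inv_one])
    -- After inversion at `v₀` the fourth point lies on the line through the other two, with weight
    -- `1 / (1 - c)`.
    have hs : (1 - c⁻¹)⁻¹ • y = vinv (v₁ - v₀) +
        (-(1 - c⁻¹)⁻¹ * c⁻¹) • (vinv (v₂ - v₀) - vinv (v₁ - v₀)) := by
      have : (1 - c⁻¹)⁻¹ = 1 + (1 - c⁻¹)⁻¹ * c⁻¹ := by
        have : (1 - c⁻¹)⁻¹ * (1 - c⁻¹) = 1 := inv_mul_cancel₀ ht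
        linarith
      simp only [y]
      nth_rewrite 1 [this]
      set T := (1 - c⁻¹)⁻¹
      have : (T * c⁻¹) • c⁻¹ • vinv (v₂ - v₀) = T • c⁻¹ • vinv (v₂ - v₀) - c⁻¹ • vinv (v₂ - v₀) := by
        simp only [smul_smul, ← sub_smul]
        congr 1
        linear_combination (-c⁻¹) * this
      rw [add_smul, one_smul, smul_sub, this]
      module
    have := concircular_inversion (p := v₀) (vinv_ne_zero h₁') (vinv_ne_zero h₂')
      (smul_ne_zero (inv_ne_zero ht) hy) hs
    rw [e₁, e₂, vinv_smul, inv_inv, ← hw, add_sub_cancel] at this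
    exact this

end Quadrilateral

/-! ### Differentiating the Clifford inverse -/

theorem hasFDerivAt_vinv {n : ℕ} {v : Rn n} (hv : v ≠ 0) :
    ∃ L : Rn n →L[ℝ] Rn n, HasFDerivAt vinv L v ∧ ∀ w, L w = -sandwich (vinv v) w := by
  have hv' : ‖v‖ ≠ 0 := norm_ne_zero_iff.2 hv
  have h1 := (hasStrictFDerivAt_norm_sq v).hasFDerivAt
  have h2 := (hasDerivAt_inv (pow_ne_zero 2 hv')).comp_hasFDerivAt v h1
  have h3 := (h2.smul (hasFDerivAt_id v)).neg
  refine ⟨_, h3, fun w => ?_⟩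
  simp only [sandwich, vinv, norm_neg, norm_smul, inner_neg_left, inner_smul_left]
  simp
  match_scalars <;> field_simp

theorem contDiffAt_vinv {n : ℕ} {v : Rn n} (hv : v ≠ 0) :
    ContDiffAt ℝ ∞ (vinv : Rn n → Rn n) v := by
  have hv' : ‖v‖ ^ 2 ≠ 0 := pow_ne_zero _ (norm_ne_zero_iff.2 hv)
  have h1 : ContDiffAt ℝ ∞ (fun v : Rn n => ‖v‖ ^ 2) v := (contDiff_norm_sq ℝ).contDiffAt
  exact ((h1.inv hv').smul contDiffAt_id).neg

theorem induced_eq {n : ℕ} {M : Type*} {r : ℝ} {f f₁ fc : M → Rn n} :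
    induced r f f₁ fc = fc + r⁻¹ • (vinv ∘ (f₁ - f)) := by
  funext x
  simp [induced, vinv_smul]

theorem induced_sub {n : ℕ} {M : Type*} {r : ℝ} {f f₁ fc : M → Rn n} (x : M) :
    induced r f f₁ fc x - fc x = vinv (r • (f₁ x - f x)) :=
  add_sub_cancel_left _ _

/-! ### Christoffel and Darboux transforms on the surface -/

section Surfaces

variable {n : ℕ} {M : Type*} [TopologicalSpace M] [ChartedSpace ℂ M]

theorem isManifold_real [IsManifold 𝓘(ℂ) ω M] : IsManifold 𝓘(ℝ, ℂ) ∞ M := by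
  refine isManifold_of_contDiffOn _ _ _ fun e e' he he' => ?_
  have h : e.symm ≫ₕ e' ∈ contDiffGroupoid ω 𝓘(ℂ) :=
    HasGroupoid.compatible he he'
  have h' := (mem_groupoid_of_pregroupoid.1 h).1
  exact (ContDiffOn.restrict_scalars ℝ h').of_le le_top

theorem Smooth.mdifferentiableAt {f : M → Rn n} (hf : Smooth f) (x : M) :
    MDifferentiableAt 𝓘(ℝ, ℂ) 𝓘(ℝ, Rn n) f x :=
  ContMDiff.mdifferentiableAt hf (by simp)

theorem Smooth.hasMFDerivAt {f : M → Rn n} (hf : Smooth f) (x : M) :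
    HasMFDerivAt 𝓘(ℝ, ℂ) 𝓘(ℝ, Rn n) f x (diff f x) :=
  (hf.mdifferentiableAt x).hasMFDerivAt

theorem Smooth.sub {f g : M → Rn n} (hf : Smooth f) (hg : Smooth g) : Smooth (f - g) :=
  ContMDiff.sub hf hg

theorem diff_sub {f g : M → Rn n} (hf : Smooth f) (hg : Smooth g) (x : M) :
    diff (f - g) x = diff f x - diff g x :=
  mfderiv_sub (hf.mdifferentiableAt x) (hg.mdifferentiableAt x)

theorem Smooth.induced {r : ℝ} {f f₁ fc : M → Rn n} (hf : Smooth f) (hf₁ : Smooth f₁)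
    (hfc : Smooth fc) (hne : ∀ x, f₁ x ≠ f x) : Smooth (induced r f f₁ fc) := by
  rw [induced_eq]
  refine ContMDiff.add hfc (ContMDiff.comp (g := fun v : Rn n => r⁻¹ • v)
    (contDiff_const_smul r⁻¹).contMDiff fun x => ?_)
  exact (contDiffAt_vinv (sub_ne_zero.2 (hne x))).contMDiffAt.comp x ((hf₁.sub hf) x)

theorem diff_induced {r : ℝ} {f f₁ fc : M → Rn n} (hf : Smooth f) (hf₁ : Smooth f₁)
    (hfc : Smooth fc) (hne : ∀ x, f₁ x ≠ f x) (x : M) (X : ℂ) :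
    diff (Isothermic.induced r f f₁ fc) x X =
      diff fc x X - r⁻¹ • sandwich (vinv (f₁ x - f x)) (diff (f₁ - f) x X) := by
  obtain ⟨L, hL, hL'⟩ := hasFDerivAt_vinv (sub_ne_zero.2 (hne x))
  have h1 := HasMFDerivAt.comp x (HasFDerivAt.hasMFDerivAt hL) ((hf₁.sub hf).hasMFDerivAt x)
  have h2 := ((hfc.hasMFDerivAt x).add (h1.const_smul r⁻¹)).mfderiv
  rw [diff, induced_eq, h2]
  change diff fc x X + r⁻¹ • L (diff (f₁ - f) x X) = _
  rw [hL', smul_neg, ← sub_eq_add_neg]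

/-- The Riccati equation of a Darboux transformation, as an identity of vectors. -/
theorem riccati_iff {r : ℝ} {f f₁ : M → Rn n} (hf : Smooth f) (hf₁ : Smooth f₁) {x : M} {X : ℂ}
    {w : Rn n} :
    emb (diff (f₁ - f) x X) =
      r • (emb (f₁ x - f x) * emb w * emb (f₁ x - f x)) - emb (diff f x X) ↔
    diff f₁ x X = r • sandwich (f₁ x - f x) w := by
  rw [← emb_sandwich, ← emb_smul, ← emb_sub, emb_injective.eq_iff, diff_sub hf₁ hf,
    sub_apply, sub_left_inj]

theorem QuadDiff.val_eq (Q : QuadDiff M) (x : M) (X Y : ℂ) :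
    Q.val x X Y = X * Y * Q.val x 1 1 := by
  have h (B : ℂ →L[ℂ] ℂ →L[ℂ] ℂ) : B X Y = X * Y * B 1 1 := by
    have h1 : B X = X • B 1 := by rw [← map_smul, smul_eq_mul, mul_one]
    have h2 : B 1 Y = Y • B 1 1 := by rw [← map_smul, smul_eq_mul, mul_one]
    rw [h1, smul_apply, h2, smul_eq_mul, smul_eq_mul, mul_assoc]
  exact h (Q x)

theorem QuadDiff.val_one_ne_zero {Q : QuadDiff M} {x : M} (h : Q x ≠ 0) : Q.val x 1 1 ≠ 0 := by
  intro h0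
  apply h
  refine ContinuousLinearMap.ext fun X => ContinuousLinearMap.ext fun Y => ?_
  have h' : Q.val x X Y = 0 := (Q.val_eq x X Y).trans (by rw [h0, mul_zero])
  exact h'

theorem part20_comm (α β : ℂ →L[ℝ] Rn n) (X Y : ℂ) : part20 α β X Y = part20 β α Y X := by
  simp only [part20, real_inner_comm (α _) (β _)]
  push_cast
  ring

theorem map_complex (α : ℂ →L[ℝ] Rn n) (X : ℂ) : α X = X.re • α 1 + X.im • α Complex.I := by
  rw [← map_smul, ← map_smul, ← map_add]
  congr 1
  apply Complex.ext <;> simp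

theorem ext_complex {α β : ℂ →L[ℝ] Rn n} (h₁ : α 1 = β 1) (h₂ : α Complex.I = β Complex.I) :
    α = β := by
  ext1 X
  rw [map_complex α, map_complex β, h₁, h₂]

theorem part20_one {α β : ℂ →L[ℝ] Rn n} :
    part20 α β 1 1 = (((inner ℝ (α 1) (β 1) - inner ℝ (α Complex.I) (β Complex.I) : ℝ) : ℂ)
      - Complex.I *
        ((inner ℝ (α Complex.I) (β 1) + inner ℝ (α 1) (β Complex.I) : ℝ) : ℂ)) / 4 := by
  simp only [part20, mul_one]

theorem part20_one_re {α β : ℂ →L[ℝ] Rn n} :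
    (part20 α β 1 1).re = (inner ℝ (α 1) (β 1) - inner ℝ (α Complex.I) (β Complex.I)) / 4 := by
  rw [part20_one]; simp [-Complex.ofReal_sub, -Complex.ofReal_add]

theorem part20_one_im {α β : ℂ →L[ℝ] Rn n} :
    (part20 α β 1 1).im = -(inner ℝ (α Complex.I) (β 1) + inner ℝ (α 1) (β Complex.I)) / 4 := by
  rw [part20_one]; simp [-Complex.ofReal_sub, -Complex.ofReal_add]

theorem part20_eq (α β : ℂ →L[ℝ] Rn n) (X Y : ℂ) :
    part20 α β X Y = X * Y * part20 α β 1 1 := by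
  rw [part20, part20_one, map_complex α X, map_complex β Y, map_complex α (_ * X),
    map_complex β (_ * Y)]
  simp only [inner_add_left, inner_add_right, inner_smul_left, inner_smul_right]
  apply Complex.ext <;> simp <;> ring

theorem conformal_iff {α : ℂ →L[ℝ] Rn n} :
    (∀ X Y, part20 α α X Y = 0) ↔
      ‖α 1‖ = ‖α Complex.I‖ ∧ (inner ℝ (α 1) (α Complex.I) : ℝ) = 0 := by
  have : (∀ X Y, part20 α α X Y = 0) ↔ part20 α α 1 1 = 0 :=
    ⟨fun h => h 1 1, fun h X Y => by rw [part20_eq, h, mul_zero]⟩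
  rw [this, Complex.ext_iff, part20_one_re, part20_one_im, real_inner_self_eq_norm_sq,
    real_inner_self_eq_norm_sq, real_inner_comm (α 1) (α Complex.I), Complex.zero_re,
    Complex.zero_im, ← pow_left_inj₀ (norm_nonneg (α 1)) (norm_nonneg _) two_ne_zero]
  constructor
  · rintro ⟨h1, h2⟩; constructor <;> linarith
  · rintro ⟨h1, h2⟩; rw [h1, h2]; simp

theorem IsChristoffel.emb_mul_eq {Q : QuadDiff M} {f fc : M → Rn n} (h : IsChristoffel Q f fc)
    (x : M) (X Y : ℂ) :
    emb (diff f x X) * emb (diff fc x Y) = emb (diff f x Y) * emb (diff fc x X) :=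
  sub_eq_zero.1 (h.wedge x X Y)

theorem IsChristoffel.symm {Q : QuadDiff M} {f fc : M → Rn n} (hf : Smooth f)
    (h : IsChristoffel Q f fc) : IsChristoffel Q fc f where
  smooth := hf
  wedge x X Y := sub_eq_zero.2 (emb_mul_eq_reverse (h.emb_mul_eq x Y X))
  part x X Y := by
    rw [part20_comm, h.part, QuadDiff.val_eq, Q.val_eq x X Y, mul_comm X]

/-- A Christoffel transform of an isothermic surface is isothermic. -/
theorem IsIsothermic.of_christoffel {Q : QuadDiff M} {f fc : M → Rn n} (hf : IsIsothermic Q f)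
    (h : IsChristoffel Q f fc) : IsIsothermic Q fc where
  smooth := h.smooth
  christoffel := ⟨f, h.symm hf.smooth⟩
  immersion x hx := by
    rw [injective_iff_map_eq_zero]
    intro X hX
    by_contra hX0
    have e := h.emb_mul_eq x X (Complex.I * X)
    rw [hX, emb_zero, mul_zero] at e
    have hX' : diff f x X ≠ 0 := fun h0 => hX0 (hf.immersion x hx (h0.trans (map_zero _).symm))
    have hIX := (emb_mul_eq_zero e).resolve_left hX'
    have hp := h.part x X X
    rw [QuadDiff.val_eq] at hp
    -- The wedge condition makes `dfᶜ` vanish on `i X` as well as on `X`, so `Q` would vanish at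
    -- `x`.
    have : part20 (diff f x) (diff fc x) X X = 0 := by
      simp only [part20, hX, hIX, inner_zero_right]; simp
    rw [this] at hp
    exact mul_ne_zero (mul_ne_zero hX0 hX0) (QuadDiff.val_one_ne_zero hx) hp.symm
  conformal x hx := by
    obtain ⟨h1, h2⟩ := conformal_iff.1 (hf.conformal x hx)
    have ha : diff f x 1 ≠ 0 := fun h0 =>
      one_ne_zero (hf.immersion x hx (h0.trans (map_zero _).symm))
    have e := h.emb_mul_eq x 1 Complex.I
    exact conformal_iff.2 ⟨norm_eq_of_emb_mul_eq ha h1 e, inner_eq_zero_of_emb_mul_eq ha h2 e⟩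

theorem IsChristoffel.diff_eq_of_ne_zero {Q : QuadDiff M} {f fc fc' : M → Rn n}
    (hf : IsIsothermic Q f) (h : IsChristoffel Q f fc) (h' : IsChristoffel Q f fc') {x : M}
    (hx : Q x ≠ 0) : diff fc x = diff fc' x := by
  obtain ⟨h1, h2⟩ := conformal_iff.1 (hf.conformal x hx)
  have ha : diff f x 1 ≠ 0 := fun h0 =>
    one_ne_zero (hf.immersion x hx (h0.trans (map_zero _).symm))
  have e := h.emb_mul_eq x 1 Complex.I
  have e' := h'.emb_mul_eq x 1 Complex.I
  have hp : part20 (diff f x) (diff fc x) 1 1 = part20 (diff f x) (diff fc' x) 1 1 :=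
    (h.part x 1 1).trans (h'.part x 1 1).symm
  have hre := congrArg Complex.re hp
  have him := congrArg Complex.im hp
  rw [part20_one_re, part20_one_re] at hre
  rw [part20_one_im, part20_one_im] at him
  obtain ⟨z1, z2⟩ := eq_zero_of_emb_mul_eq (p := diff fc x 1 - diff fc' x 1)
    (q := diff fc x Complex.I - diff fc' x Complex.I) ha h1 h2
    (by rw [emb_sub, emb_sub, mul_sub, mul_sub, e, e'])
    (by rw [inner_sub_right, inner_sub_right]; linarith)
    (by rw [inner_sub_right, inner_sub_right]; linarith)
  exact ext_complex (sub_eq_zero.1 z1) (sub_eq_zero.1 z2)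

/-- The differential of the inverse of the preferred chart at `x₀`. -/
noncomputable def chartSymmDiff (x₀ : M) (z : ℂ) : ℂ →L[ℝ] ℂ :=
  mfderiv 𝓘(ℝ, ℂ) 𝓘(ℝ, ℂ) (chartAt ℂ x₀).symm z

/-- The differential of a smooth map in a chart. -/
theorem Smooth.hasFDerivAt_comp_symm [IsManifold 𝓘(ℂ) ω M] {f : M → Rn n} (hf : Smooth f)
    (x₀ : M) {z : ℂ}
    (hz : z ∈ (chartAt ℂ x₀).target) :
    HasFDerivAt (f ∘ (chartAt ℂ x₀).symm)
      ((diff f ((chartAt ℂ x₀).symm z)).comp (chartSymmDiff x₀ z)) z := by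
  have := isManifold_real (M := M)
  have := IsManifold.of_le (I := 𝓘(ℝ, ℂ)) (M := M) (m := 1) (n := ∞) (by simp)
  have h1 := (mdifferentiableAt_atlas_symm (I := 𝓘(ℝ, ℂ)) (chart_mem_atlas ℂ x₀) hz).hasMFDerivAt
  exact (HasMFDerivAt.comp z (hf.hasMFDerivAt _) h1).hasFDerivAt

theorem Smooth.contDiffOn_comp_symm [IsManifold 𝓘(ℂ) ω M] {f : M → Rn n} (hf : Smooth f)
    (x₀ : M) :
    ContDiffOn ℝ ∞ (f ∘ (chartAt ℂ x₀).symm) (chartAt ℂ x₀).target := by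
  have := isManifold_real (M := M)
  exact contMDiffOn_iff_contDiffOn.1
    (ContMDiff.comp_contMDiffOn hf (contMDiffOn_chart_symm (I := 𝓘(ℝ, ℂ)) (x := x₀)))

theorem surjective_chartSymmDiff [IsManifold 𝓘(ℂ) ω M] (x₀ : M) {z : ℂ}
    (hz : z ∈ (chartAt ℂ x₀).target) :
    Function.Surjective (chartSymmDiff x₀ z) := by
  have := isManifold_real (M := M)
  have := IsManifold.of_le (I := 𝓘(ℝ, ℂ)) (M := M) (m := 1) (n := ∞) (by simp)
  exact (mdifferentiable_chart (I := 𝓘(ℝ, ℂ)) x₀).symm.mfderiv_surjective hz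

/-- `diff u x` refers to the preferred chart at `x`, which varies with `x`; continuity is therefore
used for the derivative in one fixed chart. -/
theorem diff_eq_zero_of_dense [IsManifold 𝓘(ℂ) ω M] {u : M → Rn n} (hu : Smooth u)
    {s : Set M} (hs : Dense s)
    (h : ∀ x ∈ s, diff u x = 0) (x₀ : M) : diff u x₀ = 0 := by
  set e := chartAt ℂ x₀
  have hx₀ : x₀ ∈ e.source := mem_chart_source ℂ x₀
  have hcont : ContinuousOn (fderiv ℝ (u ∘ e.symm)) e.target :=
    (hu.contDiffOn_comp_symm x₀).continuousOn_fderiv_of_isOpen e.open_target (by simp)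
  have hzero : fderiv ℝ (u ∘ e.symm) (e x₀) = 0 := by
    by_contra hne
    have hopen := hcont.isOpen_inter_preimage e.open_target (isOpen_compl_singleton (x := 0))
    have himg := e.isOpen_image_symm_of_subset_target hopen Set.inter_subset_left
    obtain ⟨_, ⟨z, hz, rfl⟩, hy⟩ := hs.inter_open_nonempty _ himg
      ⟨_, Set.mem_image_of_mem _ ⟨e.map_source hx₀, hne⟩⟩
    apply hz.2
    have := (hu.hasFDerivAt_comp_symm x₀ hz.1).fderiv
    exact ContinuousLinearMap.ext fun X =>
      (DFunLike.congr_fun this X).trans (DFunLike.congr_fun (h _ hy) _)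
  have h1 := (hu.hasFDerivAt_comp_symm x₀ (e.map_source hx₀)).fderiv.symm.trans hzero
  have hsurj := surjective_chartSymmDiff x₀ (e.map_source hx₀)
  have h2 : diff u (e.symm (e x₀)) = 0 := ContinuousLinearMap.ext fun X => by
    obtain ⟨Y, rfl⟩ := hsurj X
    exact DFunLike.congr_fun h1 Y
  rwa [e.left_inv hx₀] at h2

theorem IsPolarisation.dense_ne_zero [ConnectedSpace M] [IsManifold 𝓘(ℂ) ω M] {Q : QuadDiff M}
    (hQ : IsPolarisation Q) : Dense {x | Q x ≠ 0} := by
  have : IsManifold 𝓘(ℂ) 1 M := IsManifold.of_le (n := ω) le_top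
  have hcoord : ∀ e ∈ atlas ℂ M, ∀ z ∈ e.target,
      Q.val (e.symm z) (coordVector e z) (coordVector e z) = 0 ↔ Q (e.symm z) = 0 := by
    intro e he z hz
    have hne : coordVector e z ≠ 0 := fun h0 => one_ne_zero (α := ℂ)
      ((mdifferentiable_of_mem_atlas (I := 𝓘(ℂ)) he).symm.mfderiv_injective hz
        (h0.trans (map_zero _).symm))
    constructor
    · intro h
      by_contra hq
      rw [QuadDiff.val_eq] at h
      exact mul_ne_zero (mul_ne_zero hne hne) (QuadDiff.val_one_ne_zero hq) h
    · intro h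
      rw [QuadDiff.val, h]; rfl
  set Z : Set M := interior {x | Q x = 0}
  -- A coordinate ball about a limit point of `Z` meets `Z`, so the identity theorem makes the
  -- coefficient of `Q` vanish on the whole ball.
  have hclosed : IsClosed Z := by
    rw [← closure_subset_iff_isClosed]
    intro x hx
    set e := chartAt ℂ x
    have hxs : x ∈ e.source := mem_chart_source ℂ x
    obtain ⟨ε, hε, hball⟩ := Metric.isOpen_iff.1 e.open_target _ (e.map_source hxs)
    have hopen := e.isOpen_image_symm_of_subset_target Metric.isOpen_ball hball
    have hmem : x ∈ e.symm '' Metric.ball (e x) ε :=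
      ⟨e x, Metric.mem_ball_self hε, e.left_inv hxs⟩
    obtain ⟨_, ⟨z, hz, rfl⟩, hyZ⟩ := mem_closure_iff.1 hx _ hopen hmem
    have hd := (hQ.holomorphic e (chart_mem_atlas ℂ x)).mono hball
    have hev : (fun z => Q.val (e.symm z) (coordVector e z) (coordVector e z)) =ᶠ[nhds z] 0 := by
      have hc : ContinuousAt e.symm z := e.continuousAt_symm (hball hz)
      filter_upwards [hc.preimage_mem_nhds (isOpen_interior.mem_nhds hyZ),
        e.open_target.mem_nhds (hball hz)] with y hy hyt
      have hq : e.symm y ∈ {x | Q x = 0} := interior_subset hy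
      exact (hcoord e (chart_mem_atlas ℂ x) y hyt).2 hq
    have hall := (hd.analyticOnNhd Metric.isOpen_ball).eqOn_zero_of_preconnected_of_eventuallyEq_zero
      (convex_ball _ _).isPreconnected hz hev
    refine mem_interior.2 ⟨_, ?_, hopen, hmem⟩
    rintro _ ⟨y, hy, rfl⟩
    exact (hcoord e (chart_mem_atlas ℂ x) y (hball hy)).1 (hall hy)
  have hZ : Z = ∅ := by
    rcases isClopen_iff.1 ⟨hclosed, isOpen_interior⟩ with h | h
    · exact h
    · obtain ⟨x, hx⟩ := hQ.nonzero
      have hxZ : x ∈ Z := h ▸ Set.mem_univ x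
      exact absurd (interior_subset hxZ) hx
  have : {x | Q x ≠ 0} = {x | Q x = 0}ᶜ := rfl
  rw [this, ← interior_eq_empty_iff_dense_compl]
  exact hZ

theorem IsChristoffel.diff_eq [ConnectedSpace M] [IsManifold 𝓘(ℂ) ω M] {Q : QuadDiff M}
    (hQ : IsPolarisation Q) {f fc fc' : M → Rn n} (hf : IsIsothermic Q f)
    (h : IsChristoffel Q f fc) (h' : IsChristoffel Q f fc') (x : M) : diff fc x = diff fc' x := by
  rw [← sub_eq_zero, ← diff_sub h.smooth h'.smooth]
  refine diff_eq_zero_of_dense (h.smooth.sub h'.smooth) hQ.dense_ne_zero (fun y hy => ?_) x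
  rw [diff_sub h.smooth h'.smooth, h.diff_eq_of_ne_zero hf h' hy, sub_self]

theorem IsDarboux.diff_eq [ConnectedSpace M] [IsManifold 𝓘(ℂ) ω M] {Q : QuadDiff M}
    (hQ : IsPolarisation Q) {r : ℝ} {f f₁ fc : M → Rn n} (h : IsDarboux Q r f f₁)
    (hfc : IsChristoffel Q f fc) (x : M) (X : ℂ) :
    diff f₁ x X = r • sandwich (f₁ x - f x) (diff fc x X) := by
  obtain ⟨fc', hfc', hr⟩ := h.riccati
  rw [hfc.diff_eq hQ h.isothermic hfc']
  exact (riccati_iff h.isothermic.smooth h.smooth).1 (hr x X)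

theorem IsDarboux.diff_induced [ConnectedSpace M] [IsManifold 𝓘(ℂ) ω M] {Q : QuadDiff M}
    (hQ : IsPolarisation Q) {r : ℝ} {f f₁ fc : M → Rn n} (h : IsDarboux Q r f f₁)
    (hfc : IsChristoffel Q f fc) (x : M) (X : ℂ) :
    diff (induced r f f₁ fc) x X = r⁻¹ • sandwich (vinv (f₁ x - f x)) (diff f x X) := by
  rw [Isothermic.diff_induced h.isothermic.smooth h.smooth hfc.smooth h.ne,
    diff_sub h.smooth h.isothermic.smooth, sub_apply, sandwich_sub,
    h.diff_eq hQ hfc, sandwich_smul, sandwich_sandwich_vinv (sub_ne_zero.2 (h.ne x)), smul_sub,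
    smul_smul, inv_mul_cancel₀ h.param_ne_zero, one_smul, sub_sub_cancel]

theorem IsDarboux.isChristoffel_induced [ConnectedSpace M] [IsManifold 𝓘(ℂ) ω M] {Q : QuadDiff M}
    (hQ : IsPolarisation Q) {r : ℝ} {f f₁ fc : M → Rn n} (h : IsDarboux Q r f f₁)
    (hfc : IsChristoffel Q f fc) : IsChristoffel Q f₁ (induced r f f₁ fc) where
  smooth := h.isothermic.smooth.induced h.smooth hfc.smooth h.ne
  wedge x X Y := by
    have hg := sub_ne_zero.2 (h.ne x)
    have e := (hfc.symm h.isothermic.smooth).emb_mul_eq x X Y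
    simp only [cwedge, h.diff_eq hQ hfc, h.diff_induced hQ hfc, emb_smul, smul_mul_assoc,
      mul_smul_comm, emb_sandwich_mul_sandwich_vinv hg, e, sub_self]
  part x X Y := by
    have hg := sub_ne_zero.2 (h.ne x)
    have hr := h.param_ne_zero
    rw [← (hfc.symm h.isothermic.smooth).part x X Y]
    simp only [part20, h.diff_eq hQ hfc, h.diff_induced hQ hfc, inner_smul_left, inner_smul_right,
      inner_sandwich_sandwich_vinv hg, RCLike.conj_to_real,
      inv_mul_cancel_left₀ hr]

/-- The Darboux transformation induced on Christoffel transforms. -/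
theorem IsDarboux.induced [ConnectedSpace M] [IsManifold 𝓘(ℂ) ω M] {Q : QuadDiff M}
    (hQ : IsPolarisation Q) {r : ℝ} {f f₁ fc : M → Rn n} (h : IsDarboux Q r f f₁)
    (hfc : IsChristoffel Q f fc) : IsDarboux Q r fc (induced r f f₁ fc) where
  param_ne_zero := h.param_ne_zero
  isothermic := h.isothermic.of_christoffel hfc
  smooth := (h.isChristoffel_induced hQ hfc).smooth
  ne x := by
    rw [← sub_ne_zero, induced_sub]
    exact vinv_ne_zero (smul_ne_zero h.param_ne_zero (sub_ne_zero.2 (h.ne x)))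
  riccati := by
    -- The roles of `f` and `fc` are exchanged, and `r (r g)⁻¹ df (r g)⁻¹ = r⁻¹ g⁻¹ df g⁻¹`.
    refine ⟨f, hfc.symm h.isothermic.smooth, fun x X => ?_⟩
    rw [riccati_iff hfc.smooth (h.isChristoffel_induced hQ hfc).smooth, induced_sub,
      h.diff_induced hQ hfc, vinv_smul, sandwich_smul_left, smul_smul]
    congr 1
    have := h.param_ne_zero
    field_simp

end Surfaces

/-! ### Rigidity of Darboux transforms and Bianchi quadrilaterals -/

/-- The local Lipschitz bound for the quadratic right-hand side of the Riccati equation. -/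
theorem norm_sandwich_sub_sandwich_le {n : ℕ} (v v' w : Rn n) :
    ‖sandwich v w - sandwich v' w‖ ≤ 3 * (‖v‖ + ‖v'‖) * ‖w‖ * ‖v - v'‖ := by
  have e : sandwich v w - sandwich v' w =
      (‖v‖ ^ 2 - ‖v'‖ ^ 2) • w - (2 * inner ℝ v w : ℝ) • (v - v')
        - (2 * inner ℝ (v - v') w : ℝ) • v' := by
    rw [inner_sub_left, sandwich, sandwich]; module
  have h1 : ‖(‖v‖ ^ 2 - ‖v'‖ ^ 2) • w‖ ≤ (‖v‖ + ‖v'‖) * ‖w‖ * ‖v - v'‖ := by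
    have : ‖v‖ ^ 2 - ‖v'‖ ^ 2 = (‖v‖ + ‖v'‖) * (‖v‖ - ‖v'‖) := by ring
    rw [norm_smul, this, norm_mul, Real.norm_of_nonneg (by positivity : 0 ≤ ‖v‖ + ‖v'‖), mul_assoc,
      mul_assoc, mul_comm ‖w‖]
    gcongr
    exact abs_norm_sub_norm_le v v'
  have h2 : ‖(2 * inner ℝ v w : ℝ) • (v - v')‖ ≤ 2 * (‖v‖ * ‖w‖) * ‖v - v'‖ := by
    rw [norm_smul, norm_mul, Real.norm_two]
    gcongr
    exact norm_inner_le_norm v w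
  have h3 : ‖(2 * inner ℝ (v - v') w : ℝ) • v'‖ ≤ 2 * (‖v - v'‖ * ‖w‖) * ‖v'‖ := by
    rw [norm_smul, norm_mul, Real.norm_two]
    gcongr
    exact norm_inner_le_norm _ w
  rw [e]
  calc _ ≤ _ := (norm_sub_le _ _).trans (add_le_add_left (norm_sub_le _ _) _)
    _ ≤ _ := add_le_add (add_le_add h1 h2) h3
    _ = _ := by ring

/-- A map on a ball whose derivative is bounded by a multiple of its value vanishes if it vanishes
at the centre. -/
theorem eq_zero_on_ball_of_norm_fderiv_le {E F : Type*} [NormedAddCommGroup E] [NormedSpace ℝ E]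
    [NormedAddCommGroup F] [NormedSpace ℝ F] {u : E → F} {u' : E → E →L[ℝ] F} {z₀ : E} {ε C : ℝ}
    (hu : ∀ z ∈ Metric.ball z₀ ε, HasFDerivAt u (u' z) z) (h₀ : u z₀ = 0)
    (hC : ∀ z ∈ Metric.ball z₀ ε, ‖u' z‖ ≤ C * ‖u z‖) {z : E} (hz : z ∈ Metric.ball z₀ ε) :
    u z = 0 := by
  have hε : 0 < ε := Metric.pos_of_mem_ball hz
  have hmem : ∀ t ∈ Set.Icc (0 : ℝ) 1, z₀ + t • (z - z₀) ∈ Metric.ball z₀ ε := fun t ht =>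
    (convex_ball z₀ ε).add_smul_sub_mem (Metric.mem_ball_self hε) hz ht
  have hd : ∀ t ∈ Set.Icc (0 : ℝ) 1,
      HasDerivAt (fun t : ℝ => u (z₀ + t • (z - z₀))) (u' (z₀ + t • (z - z₀)) (z - z₀)) t := by
    intro t ht
    have h1 : HasDerivAt (fun t : ℝ => z₀ + t • (z - z₀)) (z - z₀) t := by
      simpa using ((hasDerivAt_id t).smul_const (z - z₀)).const_add z₀
    exact (hu _ (hmem t ht)).comp_hasDerivAt t h1
  have key := eq_zero_of_abs_deriv_le_mul_abs_self_of_eq_zero_right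
    (f := fun t : ℝ => u (z₀ + t • (z - z₀))) (K := C * ‖z - z₀‖) (a := 0) (b := 1)
    (fun t ht => (hd t ht).continuousAt.continuousWithinAt)
    (fun t ht => (hd t (Set.Ico_subset_Icc_self ht)).hasDerivWithinAt) (by simpa using h₀)
    (fun t ht => by
      refine (ContinuousLinearMap.le_opNorm _ _).trans ?_
      rw [mul_right_comm]
      gcongr
      exact hC _ (hmem t (Set.Ico_subset_Icc_self ht)))
    1 (by simp)
  simpa using key

theorem IsBianchiQuadrilateral.induced_ne {n : ℕ} {M : Type*} [TopologicalSpace M]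
    [ChartedSpace ℂ M] {Q : QuadDiff M} {r₁ r₂ : ℝ} {f f₁ fhat f₂ : M → Rn n}
    (h : IsBianchiQuadrilateral Q r₁ r₂ f f₁ fhat f₂) (fc : M → Rn n) :
    induced r₁ f f₁ fc ≠ induced r₂ f f₂ fc := by
  intro heq
  have hr₁ := h.darboux₁.param_ne_zero
  have hr₂ := h.darboux₂.param_ne_zero
  have hvinv (x : M) : vinv (f₁ x - f x) = (r₂ / r₁)⁻¹ • vinv (f₂ x - f x) := by
    have e := congrArg (fun v => r₁ • v) (add_left_cancel (congrFun heq x))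
    simp only [vinv_smul, smul_smul, mul_inv_cancel₀ hr₁, one_smul] at e
    rw [e, inv_div, div_eq_mul_inv]
  apply h.distinct
  funext x
  -- For cross-ratio `c ≠ 1`, the vector `g₁⁻¹ - c⁻¹ g₂⁻¹` is invertible, so it cannot vanish.
  by_cases hc : r₂ / r₁ = 1
  · have e := congrArg vinv (hvinv x)
    rw [hc, inv_one, one_smul, vinv_vinv (sub_ne_zero.2 (h.darboux₁.ne x)),
      vinv_vinv (sub_ne_zero.2 (h.darboux₂.ne x))] at e
    exact sub_left_injective e
  · exact absurd (sub_eq_zero.2 (hvinv x))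
      (diagonal_eq_of_crossRatio (div_ne_zero hr₂ hr₁) hc (h.darboux₁.ne x) (h.darboux₂.ne x)
        (h.darboux₁₂.ne x) (h.crossRatio_eq x)).1

theorem IsBianchiQuadrilateral.induced_eq_induced {n : ℕ} {M : Type*} [TopologicalSpace M]
    [ChartedSpace ℂ M] {Q : QuadDiff M} {r₁ r₂ : ℝ} {f f₁ fhat f₂ : M → Rn n}
    (h : IsBianchiQuadrilateral Q r₁ r₂ f f₁ fhat f₂) (fc : M → Rn n) :
    induced r₂ f₁ fhat (induced r₁ f f₁ fc) = induced r₁ f₂ fhat (induced r₂ f f₂ fc) := by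
  funext x
  simp only [induced, add_assoc]
  rw [induced_vertices_eq h.darboux₁.param_ne_zero h.darboux₂.param_ne_zero (h.darboux₁.ne x)
    (h.darboux₂.ne x) (h.darboux₁₂.ne x) (h.darboux₂₁.ne x) (h.crossRatio_eq x)]

section Surfaces

variable {n : ℕ} {M : Type*} [TopologicalSpace M] [ConnectedSpace M] [ChartedSpace ℂ M]
  [IsManifold 𝓘(ℂ) ω M] {Q : QuadDiff M}

/-- Darboux transforms with the same parameter that agree at one point are equal. -/
theorem IsDarboux.eq_of_apply_eq (hQ : IsPolarisation Q) {r : ℝ} {f f₁ f₂ : M → Rn n}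
    (h₁ : IsDarboux Q r f f₁) (h₂ : IsDarboux Q r f f₂) {x : M} (hx : f₁ x = f₂ x) : f₁ = f₂ := by
  obtain ⟨fc, hfc⟩ := h₁.isothermic.christoffel
  have hf := h₁.isothermic.smooth
  have hclosed : IsClosed {x | f₁ x = f₂ x} :=
    isClosed_eq (ContMDiff.continuous h₁.smooth) (ContMDiff.continuous h₂.smooth)
  have hopen : IsOpen {x | f₁ x = f₂ x} := by
    rw [isOpen_iff_mem_nhds]
    intro x₀ hx₀
    set e := chartAt ℂ x₀
    have hxs : x₀ ∈ e.source := mem_chart_source ℂ x₀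
    have hcont {g : M → Rn n} (hg : Smooth g) : ContinuousOn (fun z => g (e.symm z)) e.target :=
      (hg.contDiffOn_comp_symm x₀).continuousOn
    have hDc : ContinuousOn (fderiv ℝ (fc ∘ e.symm)) e.target :=
      (hfc.smooth.contDiffOn_comp_symm x₀).continuousOn_fderiv_of_isOpen e.open_target (by simp)
    -- `K z` bounds the derivative of `f₁ - f₂` at `z` by a multiple of its value; by continuity `K
    -- (e x₀) + 1` serves on a whole ball, where Grönwall's argument along rays applies.
    set K : ℂ → ℝ := fun z => |r| * (3 * (‖f₁ (e.symm z) - f (e.symm z)‖ +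
      ‖f₂ (e.symm z) - f (e.symm z)‖) * ‖fderiv ℝ (fc ∘ e.symm) z‖)
    have hK : ContinuousOn K e.target :=
      continuousOn_const.mul ((continuousOn_const.mul
        ((((hcont h₁.smooth).sub (hcont hf)).norm).add
          (((hcont h₂.smooth).sub (hcont hf)).norm))).mul hDc.norm)
    have htgt : e.target ∈ nhds (e x₀) := e.open_target.mem_nhds (e.map_source hxs)
    have hev : ∀ᶠ z in nhds (e x₀), z ∈ e.target ∧ K z < K (e x₀) + 1 :=
      (show ∀ᶠ z in nhds (e x₀), z ∈ e.target from htgt).and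
        ((hK.continuousAt htgt).eventually (gt_mem_nhds (lt_add_one _)))
    obtain ⟨ε, hε, hball⟩ := Metric.eventually_nhds_iff_ball.1 hev
    have hu : ∀ z ∈ Metric.ball (e x₀) ε, HasFDerivAt ((f₁ - f₂) ∘ e.symm)
        ((diff (f₁ - f₂) (e.symm z)).comp (chartSymmDiff x₀ z)) z := fun z hz =>
      (h₁.smooth.sub h₂.smooth).hasFDerivAt_comp_symm x₀ (hball z hz).1
    have hzero : ∀ z ∈ Metric.ball (e x₀) ε, ((f₁ - f₂) ∘ e.symm) z = 0 := by
      intro z hz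
      refine eq_zero_on_ball_of_norm_fderiv_le (C := K (e x₀) + 1) hu ?_ (fun y hy => ?_) hz
      · change f₁ (e.symm (e x₀)) - f₂ (e.symm (e x₀)) = 0
        rw [e.left_inv hxs]
        exact sub_eq_zero.2 hx₀
      · refine (ContinuousLinearMap.opNorm_le_bound _
          (mul_nonneg (by positivity) (norm_nonneg _)) fun ζ => ?_).trans
          (mul_le_mul_of_nonneg_right (hball y hy).2.le (norm_nonneg _))
        have hD : fderiv ℝ (fc ∘ e.symm) y ζ = diff fc (e.symm y) (chartSymmDiff x₀ y ζ) :=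
          DFunLike.congr_fun (hfc.smooth.hasFDerivAt_comp_symm x₀ (hball y hy).1).fderiv ζ
        rw [ContinuousLinearMap.comp_apply, diff_sub h₁.smooth h₂.smooth, sub_apply,
          h₁.diff_eq hQ hfc, h₂.diff_eq hQ hfc, ← hD, ← smul_sub, norm_smul, Real.norm_eq_abs]
        set w := fderiv ℝ (fc ∘ e.symm) y ζ
        have hw : ‖w‖ ≤ ‖fderiv ℝ (fc ∘ e.symm) y‖ * ‖ζ‖ := ContinuousLinearMap.le_opNorm _ _
        have hs := norm_sandwich_sub_sandwich_le (f₁ (e.symm y) - f (e.symm y))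
          (f₂ (e.symm y) - f (e.symm y)) w
        rw [sub_sub_sub_cancel_right] at hs
        calc _ ≤ |r| * (3 * (‖f₁ (e.symm y) - f (e.symm y)‖ + ‖f₂ (e.symm y) - f (e.symm y)‖) *
              (‖fderiv ℝ (fc ∘ e.symm) y‖ * ‖ζ‖) * ‖f₁ (e.symm y) - f₂ (e.symm y)‖) := by
              refine mul_le_mul_of_nonneg_left (hs.trans ?_) (abs_nonneg r)
              gcongr
          _ = _ := by simp only [K, Function.comp_apply, Pi.sub_apply]; ring
    have himg := e.isOpen_image_symm_of_subset_target Metric.isOpen_ball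
      (fun z hz => (hball z hz).1)
    refine Filter.mem_of_superset
      (himg.mem_nhds ⟨e x₀, Metric.mem_ball_self hε, e.left_inv hxs⟩) ?_
    rintro _ ⟨z, hz, rfl⟩
    exact sub_eq_zero.1 (hzero z hz)
  have huniv := IsClopen.eq_univ ⟨hclosed, hopen⟩ ⟨x, hx⟩
  funext y
  exact (huniv ▸ Set.mem_univ y : y ∈ {x | f₁ x = f₂ x})

/-- Bianchi quadrilaterals are determined by three of their surfaces. -/
theorem IsBianchiQuadrilateral.eq_of_eq (hQ : IsPolarisation Q) {r₁ r₂ : ℝ}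
    {f f₁ f₂ u w : M → Rn n} (hu : IsBianchiQuadrilateral Q r₁ r₂ f f₁ u f₂)
    (hw : IsBianchiQuadrilateral Q r₁ r₂ f f₁ w f₂) : u = w := by
  have hr₁ := hu.darboux₁.param_ne_zero
  have hr₂ := hu.darboux₂.param_ne_zero
  funext x
  have h₁ := hu.darboux₁.ne x
  have h₂ := hu.darboux₂.ne x
  have hcu := hu.crossRatio_eq x
  have hcw := hw.crossRatio_eq x
  -- With equal parameters both candidates equal `f`, since `f₁` and `f₂` meet nowhere.
  by_cases hc : r₂ / r₁ = 1
  · have hne : f₁ x ≠ f₂ x := by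
      obtain rfl := (div_eq_one_iff_eq hr₁).1 hc
      exact fun h => hu.distinct (hu.darboux₁.eq_of_apply_eq hQ hu.darboux₂ h)
    rw [hc] at hcu hcw
    rw [(eq_or_eq_of_crossRatio_one h₁ h₂ (hu.darboux₁₂.ne x) hcu).resolve_right hne,
      (eq_or_eq_of_crossRatio_one h₁ h₂ (hw.darboux₁₂.ne x) hcw).resolve_right hne]
  · have hc₀ := div_ne_zero hr₂ hr₁
    have eu := (diagonal_eq_of_crossRatio hc₀ hc h₁ h₂ (hu.darboux₁₂.ne x) hcu).2
    have ew := (diagonal_eq_of_crossRatio hc₀ hc h₁ h₂ (hw.darboux₁₂.ne x) hcw).2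
    exact sub_left_injective (eu.trans ew.symm)

theorem IsBianchiQuadrilateral.induced (hQ : IsPolarisation Q) {r₁ r₂ : ℝ}
    {f f₁ fhat f₂ fc : M → Rn n} (h : IsBianchiQuadrilateral Q r₁ r₂ f f₁ fhat f₂)
    (hfc : IsChristoffel Q f fc) :
    IsBianchiQuadrilateral Q r₁ r₂ fc (induced r₁ f f₁ fc)
      (induced r₂ f₁ fhat (induced r₁ f f₁ fc)) (induced r₂ f f₂ fc) := by
  have c₁ := h.darboux₁.isChristoffel_induced hQ hfc
  have c₂ := h.darboux₂.isChristoffel_induced hQ hfc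
  have c₁₂ := h.darboux₁₂.isChristoffel_induced hQ c₁
  have d₁ := h.darboux₁.induced hQ hfc
  have d₂ := h.darboux₂.induced hQ hfc
  have d₁₂ := h.darboux₁₂.induced hQ c₁
  have d₂₁ := h.darboux₂₁.induced hQ c₂
  have heq := h.induced_eq_induced fc
  have hr₁ := h.darboux₁.param_ne_zero
  have hr₂ := h.darboux₂.param_ne_zero
  have hcr (x : M) := crossRatio_induced hr₁ hr₂ (h.darboux₁.ne x)
    (h.darboux₂.ne x) (h.darboux₁₂.ne x) (h.darboux₂₁.ne x) (h.crossRatio_eq x)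
    (induced_sub (fc := fc) x) (induced_sub (fc := fc) x)
    (induced_sub (fc := Isothermic.induced r₁ f f₁ fc) x)
    (by rw [heq]; exact induced_sub x)
  exact {
    darboux₁ := d₁
    darboux₂ := d₂
    distinct := h.induced_ne fc
    isothermic := h.isothermic.of_christoffel c₁₂
    darboux₁₂ := d₁₂
    darboux₂₁ := heq ▸ d₂₁
    concircular := fun x => concircular_of_crossRatio (div_ne_zero hr₂ hr₁) (d₁.ne x) (d₂.ne x)
      (d₁₂.ne x) (hcr x)
    crossRatio_eq := hcr }

end Surfaces

end Isothermic

theorem mainTheorem10 {n : ℕ} {M : Type*} [TopologicalSpace M] [T2Space M] [ConnectedSpace M]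
    [ChartedSpace ℂ M] [IsManifold 𝓘(ℂ) ω M]
    (Q : Isothermic.QuadDiff M) (hQ : Isothermic.IsPolarisation Q)
    (r₁ r₂ : ℝ) (f f₁ fhat f₂ : M → Isothermic.Rn n)
    (hquad : Isothermic.IsBianchiQuadrilateral Q r₁ r₂ f f₁ fhat f₂)
    (fc f₁c f₂c : M → Isothermic.Rn n) (hfc : Isothermic.IsChristoffel Q f fc)
    (hf₁c : f₁c = Isothermic.induced r₁ f f₁ fc)
    (hf₂c : f₂c = Isothermic.induced r₂ f f₂ fc) :
    Isothermic.IsChristoffel Q f₁ f₁c ∧ Isothermic.IsChristoffel Q f₂ f₂c ∧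
    ∃ fhatc : M → Isothermic.Rn n,
      Isothermic.IsChristoffel Q fhat fhatc ∧
      Isothermic.IsBianchiQuadrilateral Q r₁ r₂ fc f₁c fhatc f₂c ∧
      (∀ h : M → Isothermic.Rn n,
        Isothermic.IsBianchiQuadrilateral Q r₁ r₂ fc f₁c h f₂c → h = fhatc) ∧
      fhatc = Isothermic.induced r₂ f₁ fhat f₁c ∧
      fhatc = Isothermic.induced r₁ f₂ fhat f₂c := by
  subst hf₁c hf₂c
  have c₁ := hquad.darboux₁.isChristoffel_induced hQ hfc
  have hdual := hquad.induced hQ hfc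
  exact ⟨c₁, hquad.darboux₂.isChristoffel_induced hQ hfc, _,
    hquad.darboux₁₂.isChristoffel_induced hQ c₁, hdual, fun _ hu => hu.eq_of_eq hQ hdual, rfl,
    hquad.induced_eq_induced fc⟩
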